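/- **Notation.** $M(\mathbb{R}^n)$ is the set of complex Borel measures on $\mathbb{R}^n$, a unital Banach algebra under convolution $*$ and the total variation norm, with unit the Dirac measure $\delta_0$. A measure $\mu\in M(\mathbb{R}^n)$ is *invertible* if $\mu' * \mu=\delta_0$ for some $\mu'\in M(\mathbb{R}^n)$; $\exp(\nu)=\sum_{j\ge 0}\frac{1}{j!}\nu^{*j}$, with convergence in total variation norm and $\nu^{*0}=\delta_0$; $\widehat\mu(z)=\int_{\mathbb{R}^n} e^{i z^Tx}\,\mu(dx)$; and $\lambda^n$ is Lebesgue measure. Let $\mathcal{B}_0^n$ be the system of Borel sets $B\subset\mathbb{R}^n$ that are disjoint from $\{|x|\le r\}$ for some $r>0$. A *Lévy measure* is a positive Borel measure $\rho$ on $\mathbb{R}^n$ with $\rho(\{0\})=0$ and $\int\min(1,|x|^2)\,\rho(dx)<\infty$. A *complex Lévy type measure integrating $\min(1,|x|)$* is a set function $\nu:\mathcal{B}_0^n\to\mathbb{C}$ of the form $\nu=\rho_1-\rho_2+i(\rho_3-\rho_4)$ on $\mathcal{B}_0^n$ with Lévy measures $\rho_k$ satisfying $\int\min(1,|x|)\,\rho_k(dx)<\infty$;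 for measurable $h:\mathbb{R}^n\to\mathbb{C}$ with $|h(x)|\le C\min(1,|x|)$ for some constant $C$, put $\int h\,d\nu=\int h\,d\rho_1-\int h\,d\rho_2+i\left(\int h\,d\rho_3-\int h\,d\rho_4\right)$, which does not depend on the choice of the $\rho_k$. Finally, $\mathrm{CLK}_0^n$ is the set of all $\mu\in M(\mathbb{R}^n)$ for which there are $c\in\mathbb{C}\setminus\{0\}$, $\gamma\in\mathbb{R}^n$ and a complex Lévy type measure $\nu$ integrating $\min(1,|x|)$ such that $$\widehat\mu(z)=c\,\exp\Bigl(i\gamma^Tz+\int_{\mathbb{R}^n}\bigl(e^{iz^Tx}-1\bigr)\,\nu(dx)\Bigr)\qquad\text{for all } z\in\mathbb{R}^n.\tag{1}$$ **Theorem 4.3.** Let $n\ge 2$ and let $\mu\in M(\mathbb{R}^n)$ be of the form $\mu=\alpha\delta_0+f\lambda^n$ with $\alpha\in\mathbb{C}\setminus\{0\}$ and $f\in L^1(\mathbb{R}^n)$ complex-valued. Then the following are equivalent: - (i) $\mu$ is invertible. - (iv) $\mu\in\mathrm{CLK}_0^n$. - (v') $\mu\in\mathrm{CLK}_0^n$,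 where (1) holds with $\gamma=0$ and with a complex Lévy type measure $\nu$ of the form $\nu(dx)=g(x)\,\lambda^n(dx)$ for some complex-valued $g\in L^1(\mathbb{R}^n)$, that is, $\nu(B)=\int_B g\,d\lambda^n$ for all $B\in\mathcal{B}_0^n$. - (vi') There is $\nu'\in M(\mathbb{R}^n)$ such that $\mu=\exp(\nu')$. -/

import Mathlib

noncomputable section

open MeasureTheory Filter Topology Set
open scoped ENNReal

namespace InvertibleMeasures

/-- Euclidean space `ℝⁿ`. The set `M(ℝⁿ)` of complex Borel measures on it is
`ComplexMeasure (Eucl n)`. -/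
abbrev Eucl (n : ℕ) := EuclideanSpace ℝ (Fin n)

/-- Complex measures have finite total variation; hence products of complex measures exist and
bounded measurable functions are integrable with respect to them. -/
instance isFiniteMeasure_variation {X : Type*} [MeasurableSpace X] (μ : ComplexMeasure X) :
    IsFiniteMeasure μ.variation := by
  have hle : μ.variation ≤ (ComplexMeasure.re μ).variation + (ComplexMeasure.im μ).variation := by
    refine VectorMeasure.variation_le_of_forall_enorm_le fun s _ => ?_
    have h1 : ‖μ s‖ₑ ≤ ‖(μ s).re‖ₑ + ‖(μ s).im‖ₑ := by
      rw [← ofReal_norm, ← ofReal_norm, ← ofReal_norm,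
        ← ENNReal.ofReal_add (norm_nonneg _) (norm_nonneg _)]
      exact ENNReal.ofReal_le_ofReal (Complex.norm_le_abs_re_add_abs_im _)
    refine h1.trans ?_
    rw [Measure.add_apply]
    exact add_le_add
      (VectorMeasure.enorm_measure_le_variation (ComplexMeasure.re μ) s)
      (VectorMeasure.enorm_measure_le_variation (ComplexMeasure.im μ) s)
  rw [← SignedMeasure.totalVariation_eq_variation,
    ← SignedMeasure.totalVariation_eq_variation] at hle
  have h1 : IsFiniteMeasure (ComplexMeasure.re μ).totalVariation := by
    unfold SignedMeasure.totalVariation; infer_instance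
  have h2 : IsFiniteMeasure (ComplexMeasure.im μ).totalVariation := by
    unfold SignedMeasure.totalVariation; infer_instance
  exact isFiniteMeasure_of_le _ hle

/-! ### The convolution algebra `M(ℝⁿ)` -/

/-- The unit `δ₀` of the convolution algebra. -/
def delta0 (n : ℕ) : ComplexMeasure (Eucl n) := VectorMeasure.dirac 0 1

/-- Convolution of complex measures: the image of the product measure under addition. -/
def conv {n : ℕ} (μ ν : ComplexMeasure (Eucl n)) : ComplexMeasure (Eucl n) :=
  (μ.prod ν (ContinuousLinearMap.mul ℝ ℂ)).map fun p => p.1 + p.2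

/-- The `j`-fold convolution of `ν` with itself. -/
def convPow {n : ℕ} (ν : ComplexMeasure (Eucl n)) : ℕ → ComplexMeasure (Eucl n)
  | 0 => delta0 n
  | j + 1 => conv ν (convPow ν j)

/-- `μ` is invertible in the convolution algebra. -/
def IsInvertible {n : ℕ} (μ : ComplexMeasure (Eucl n)) : Prop :=
  ∃ μ' : ComplexMeasure (Eucl n), conv μ' μ = delta0 n

/-- `μ = exp ν`: the partial sums of `∑ j, ν^{*j} / j!` converge to `μ` in total variation norm. -/
def IsExp {n : ℕ} (ν μ : ComplexMeasure (Eucl n)) : Prop :=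
  Tendsto (fun N : ℕ =>
      (μ - ∑ j ∈ Finset.range N, ((j.factorial : ℂ)⁻¹) • convPow ν j).variation univ)
    atTop (𝓝 0)

/-- The characteristic function `z ↦ ∫ exp(i zᵀx) μ(dx)`. -/
def charFn {n : ℕ} (μ : ComplexMeasure (Eucl n)) (z : Eucl n) : ℂ :=
  μ.integral (fun x => Complex.exp (Complex.I * (inner ℝ z x : ℝ))) (ContinuousLinearMap.mul ℝ ℂ)

/-! ### Complex Lévy type measures -/

/-- The Borel sets that are bounded away from zero. -/
abbrev AwayFromZero (n : ℕ) : Type :=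
  {B : Set (Eucl n) // MeasurableSet B ∧ ∃ r : ℝ, 0 < r ∧ B ∩ Metric.closedBall 0 r = ∅}

/-- (Positive) Lévy measures. -/
def IsLevyMeasure {n : ℕ} (ρ : Measure (Eucl n)) : Prop :=
  ρ {0} = 0 ∧ ∫⁻ x, ENNReal.ofReal (min 1 (‖x‖ ^ 2)) ∂ρ < ∞

/-- `ν = ρ₀ - ρ₁ + i (ρ₂ - ρ₃)` on the sets bounded away from zero, for four Lévy measures `ρᵢ`
integrating `min(1, |x|)`. -/
structure IsLevyDecomp {n : ℕ} (ρ : Fin 4 → Measure (Eucl n)) (ν : AwayFromZero n → ℂ) :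
    Prop where
  levy : ∀ i, IsLevyMeasure (ρ i)
  lintegral_lt_top : ∀ i, ∫⁻ x, ENNReal.ofReal (min 1 ‖x‖) ∂(ρ i) < ∞
  eq : ∀ B : AwayFromZero n,
    ν B = ((ρ 0).real B.1 - (ρ 1).real B.1 : ℂ) + Complex.I * ((ρ 2).real B.1 - (ρ 3).real B.1 : ℂ)

/-- The set function `ν` is a complex Lévy type measure integrating `min(1, |x|)`. -/
def IsComplexLevyType {n : ℕ} (ν : AwayFromZero n → ℂ) : Prop :=
  ∃ ρ : Fin 4 → Measure (Eucl n), IsLevyDecomp ρ ν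

/-- `∫ f dρ₀ - ∫ f dρ₁ + i (∫ f dρ₂ - ∫ f dρ₃)`. -/
def decompIntegral {n : ℕ} (ρ : Fin 4 → Measure (Eucl n)) (f : Eucl n → ℂ) : ℂ :=
  (∫ x, f x ∂(ρ 0) - ∫ x, f x ∂(ρ 1)) + Complex.I * (∫ x, f x ∂(ρ 2) - ∫ x, f x ∂(ρ 3))

open Classical in
/-- The integral of `f` with respect to a complex Lévy type measure `ν` integrating `min(1, |x|)`,
for measurable `f` with `|f(x)| ≤ C min(1, |x|)`. It is computed from some decomposition of `ν`;
by `levyIntegral_eq` the value does not depend on which one. -/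
def levyIntegral {n : ℕ} (ν : AwayFromZero n → ℂ) (f : Eucl n → ℂ) : ℂ :=
  if h : IsComplexLevyType ν then decompIntegral h.choose f else 0

lemma integrable_of_le_min {n : ℕ} {ρ : Measure (Eucl n)}
    (hρ : ∫⁻ x, ENNReal.ofReal (min 1 ‖x‖) ∂ρ < ∞) {f : Eucl n → ℂ} (hf : Measurable f) {C : ℝ}
    (hC : ∀ x, ‖f x‖ ≤ C * min 1 ‖x‖) : Integrable f ρ := by
  have h : Integrable (fun x : Eucl n => min 1 ‖x‖) ρ := by
    refine ⟨by fun_prop, ?_⟩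
    rw [hasFiniteIntegral_iff_ofReal (ae_of_all _ fun x => by positivity)]
    exact hρ
  exact (h.const_mul C).mono' hf.aestronglyMeasurable (ae_of_all _ hC)

lemma measure_lt_top_of_away {n : ℕ} {ρ : Measure (Eucl n)}
    (hρ : ∫⁻ x, ENNReal.ofReal (min 1 ‖x‖) ∂ρ < ∞) (B : AwayFromZero n) : ρ B.1 < ∞ := by
  obtain ⟨B, hB, r, hr, hBr⟩ := B
  have hpos : (0 : ℝ) < min 1 r := lt_min one_pos hr
  have hsub : B ⊆ {x | ENNReal.ofReal (min 1 r) ≤ ENNReal.ofReal (min 1 ‖x‖)} := by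
    intro x hx
    refine ENNReal.ofReal_le_ofReal (min_le_min le_rfl ?_)
    by_contra! hlt
    exact (hBr ▸ (⟨hx, by simpa using hlt.le⟩ : x ∈ B ∩ Metric.closedBall 0 r) : x ∈ (∅ : Set _))
  refine (measure_mono hsub).trans_lt ?_
  exact meas_ge_le_lintegral_div (by fun_prop) (by simpa using hr) ENNReal.ofReal_ne_top
    |>.trans_lt (ENNReal.div_lt_top hρ.ne (by simpa using hr))

lemma measure_ext_of_away {n : ℕ} {ρ σ : Measure (Eucl n)} (h0 : ρ {0} = 0) (h0' : σ {0} = 0)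
    (h : ∀ B : AwayFromZero n, ρ B.1 = σ B.1) : ρ = σ := by
  ext s hs
  let A : ℕ → Set (Eucl n) := fun k => {x | (1 : ℝ) / (k + 1) < ‖x‖}
  have hA : Monotone fun k => s ∩ A k := by
    intro k l hkl x hx
    refine ⟨hx.1, lt_of_le_of_lt (b := (1 : ℝ) / (k + 1)) ?_ hx.2⟩
    exact one_div_le_one_div_of_le (by positivity) (by exact_mod_cast Nat.succ_le_succ hkl)
  have hAm : ∀ k, MeasurableSet (A k) := fun k => measurableSet_lt measurable_const measurable_norm
  have hU : (⋃ k, s ∩ A k) = s \ {0} := by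
    ext x
    simp only [mem_iUnion, mem_inter_iff, Set.mem_sdiff, mem_singleton_iff]
    constructor
    · rintro ⟨k, hx, hk⟩
      refine ⟨hx, fun h => ?_⟩
      subst h
      have : (0 : ℝ) < 1 / ((k : ℝ) + 1) := by positivity
      have hk' : (1 : ℝ) / (k + 1) < ‖(0 : Eucl n)‖ := hk
      rw [norm_zero] at hk'
      linarith
    · rintro ⟨hx, hne⟩
      obtain ⟨k, hk⟩ := exists_nat_one_div_lt (norm_pos_iff.2 hne)
      exact ⟨k, hx, hk⟩
  have key : ∀ τ : Measure (Eucl n), τ {0} = 0 → τ s = ⨆ k, τ (s ∩ A k) := by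
    intro τ hτ
    rw [← hA.measure_iUnion, hU, measure_sdiff_null hτ]
  rw [key ρ h0, key σ h0']
  refine iSup_congr fun k => ?_
  refine h ⟨s ∩ A k, hs.inter (hAm k), 1 / (k + 1), by positivity, ?_⟩
  ext x
  simp only [mem_inter_iff, Metric.mem_closedBall, dist_zero_right, mem_empty_iff_false, iff_false,
    not_and, not_le]
  exact fun hx => hx.2

/-- Each decomposition of a complex Lévy type measure integrating `min(1, |x|)` yields the same
integral. -/
theorem levyIntegral_eq {n : ℕ} {ρ : Fin 4 → Measure (Eucl n)} {ν : AwayFromZero n → ℂ}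
    (h : IsLevyDecomp ρ ν) {f : Eucl n → ℂ} (hf : Measurable f) {C : ℝ}
    (hC : ∀ x, ‖f x‖ ≤ C * min 1 ‖x‖) :
    levyIntegral ν f = decompIntegral ρ f := by
  have hex : IsComplexLevyType ν := ⟨ρ, h⟩
  rw [levyIntegral, dif_pos hex]
  have h' := hex.choose_spec
  generalize hex.choose = σ at h'
  have cancel : ∀ i j : Fin 4,
      (∀ B : AwayFromZero n,
        (σ i).real B.1 - (σ j).real B.1 = (ρ i).real B.1 - (ρ j).real B.1) →
      ∫ x, f x ∂(σ i) - ∫ x, f x ∂(σ j) = ∫ x, f x ∂(ρ i) - ∫ x, f x ∂(ρ j) := by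
    intro i j he
    have hm : σ i + ρ j = ρ i + σ j := by
      refine measure_ext_of_away (by simp [(h'.levy i).1, (h.levy j).1])
        (by simp [(h.levy i).1, (h'.levy j).1]) fun B => ?_
      have ta := (measure_lt_top_of_away (h'.lintegral_lt_top i) B).ne
      have tb := (measure_lt_top_of_away (h'.lintegral_lt_top j) B).ne
      have tc := (measure_lt_top_of_away (h.lintegral_lt_top i) B).ne
      have td := (measure_lt_top_of_away (h.lintegral_lt_top j) B).ne
      rw [Measure.add_apply, Measure.add_apply, ← ENNReal.toReal_eq_toReal_iff' (by simp [ta, td])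
        (by simp [tc, tb]), ENNReal.toReal_add ta td, ENNReal.toReal_add tc tb]
      have := he B
      simp only [Measure.real] at this
      linarith
    have hi : ∫ x, f x ∂(σ i + ρ j) = ∫ x, f x ∂(ρ i + σ j) := by rw [hm]
    rw [integral_add_measure (integrable_of_le_min (h'.lintegral_lt_top i) hf hC)
        (integrable_of_le_min (h.lintegral_lt_top j) hf hC),
      integral_add_measure (integrable_of_le_min (h.lintegral_lt_top i) hf hC)
        (integrable_of_le_min (h'.lintegral_lt_top j) hf hC)] at hi
    linear_combination hi
  rw [decompIntegral, decompIntegral,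
    cancel 0 1 fun B => by simpa using congrArg Complex.re ((h'.eq B).symm.trans (h.eq B)),
    cancel 2 3 fun B => by simpa using congrArg Complex.im ((h'.eq B).symm.trans (h.eq B))]

/-- The integrand of the Lévy–Khintchine type formula is bounded by a multiple of `min(1, |x|)`. -/
lemma norm_exp_sub_one_le {n : ℕ} (z x : Eucl n) :
    ‖Complex.exp (Complex.I * (inner ℝ z x : ℝ)) - 1‖ ≤ (2 + ‖z‖) * min 1 ‖x‖ := by
  have h1 : ‖Complex.exp (Complex.I * (inner ℝ z x : ℝ)) - 1‖ ≤ 2 := by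
    refine (norm_sub_le _ _).trans ?_
    rw [mul_comm, Complex.norm_exp_ofReal_mul_I, norm_one]
    norm_num
  have h2 : ‖Complex.exp (Complex.I * (inner ℝ z x : ℝ)) - 1‖ ≤ ‖z‖ * ‖x‖ :=
    (Real.norm_exp_I_mul_ofReal_sub_one_le).trans (norm_inner_le_norm z x)
  rcases le_total 1 ‖x‖ with h | h
  · rw [min_eq_left h]; nlinarith [norm_nonneg z]
  · rw [min_eq_right h]; nlinarith [norm_nonneg z, norm_nonneg x]

/-! ### Lévy–Khintchine type representations -/

/-- `μ` has the Lévy–Khintchine type representation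
`μ̂(z) = c exp (i γᵀz + ∫ (exp(i zᵀx) - 1) ν(dx))`, where `c ≠ 0` and `ν` is a complex Lévy type
measure integrating `min(1, |x|)`. -/
structure HasLKRep {n : ℕ} (μ : ComplexMeasure (Eucl n)) (c : ℂ) (γ : Eucl n)
    (ν : AwayFromZero n → ℂ) : Prop where
  ne_zero : c ≠ 0
  levyType : IsComplexLevyType ν
  charFn_eq : ∀ z : Eucl n, charFn μ z =
    c * Complex.exp (Complex.I * (inner ℝ γ z : ℝ) +
      levyIntegral ν fun x => Complex.exp (Complex.I * (inner ℝ z x : ℝ)) - 1)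

/-- The class `CLK₀ⁿ`. -/
def CLK (n : ℕ) : Set (ComplexMeasure (Eucl n)) :=
  {μ | ∃ (c : ℂ) (γ : Eucl n) (ν : AwayFromZero n → ℂ), HasLKRep μ c γ ν}

/-- `ν(dx) = g(x) dx`, as set functions on the sets bounded away from zero. -/
def HasDensity {n : ℕ} (ν : AwayFromZero n → ℂ) (g : Eucl n → ℂ) : Prop :=
  ∀ B : AwayFromZero n, ν B = ∫ x in B.1, g x

end InvertibleMeasures

end

noncomputable section

open MeasureTheory Filter Topology Set
open scoped ENNReal FourierTransform SchwartzMap Convolution ContDiff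

/-! Each of the conditions (i), (iv), (vi') forces the characteristic function of `μ` to have no
zeros, and (v') is a special case of (iv). The substance is the converse: a zero-free characteristic
function already yields (v'). After division by `α` and a rescaling of the variable this is a
Wiener–Lévy theorem, `exists_exp_fourier_eq`: if `1 + 𝓕 f` has no zeros, then it equals `exp (𝓕 g)`
with `g` integrable.

For its proof, `𝓕 f` is approximated in the Fourier algebra (transforms of `L¹` functions, with the
`L¹` norm) by a smooth compactly supported `u`, and `1 + 𝓕 f = (1 + u)(1 + h)` with `h = (𝓕 f - u) /
(1 + u)`. The first factor has a smooth compactly supported logarithm (`exists_compactSupport_log`),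
and such functions lie in the algebra. Here `n ≥ 2` enters: the exterior of a ball is connected, so
a continuous logarithm takes a single value there and can be normalised to vanish. The second factor
is treated by the power series of the logarithm. The norm of `1 / (1 + u)` cannot be controlled in
advance of choosing `u`, but the growth rate of its powers can, since it is governed by `sup |1 / (1
+ u)|` (`exists_isFourierL1_inv_pow`); hence the series converges.

Given `g`, (v') holds with density `g`, and `μ` is the exponential of `g λⁿ` plus a multiple of
`δ₀`. Exponentials are invertible, with inverse `exp (-ν')`. All identities between measures are
checked on characteristic functions, which determine a complex measure (`ext_of_charFn`). -/

namespace InvertibleMeasures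

/-! ### The Fourier algebra and its norm. -/

section FourierL1

variable {V : Type*} [NormedAddCommGroup V] [InnerProductSpace ℝ V] [FiniteDimensional ℝ V]
  [MeasurableSpace V] [BorelSpace V]

/-- `u` is the Fourier transform of an integrable function of `L¹` norm at most `M`. -/
def IsFourierL1 (u : V → ℂ) (M : ℝ) : Prop :=
  ∃ h : Lp ℂ 1 (volume : Measure V), (∀ ξ, Real.Lp.fourierTransform h ξ = u ξ) ∧ ‖h‖ ≤ M

lemma IsFourierL1.mono {u : V → ℂ} {M N : ℝ} (h : IsFourierL1 u M) (hMN : M ≤ N) :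
    IsFourierL1 u N := by
  obtain ⟨f, hf, hM⟩ := h
  exact ⟨f, hf, hM.trans hMN⟩

lemma IsFourierL1.nonneg {u : V → ℂ} {M : ℝ} (h : IsFourierL1 u M) : 0 ≤ M := by
  obtain ⟨f, -, hM⟩ := h
  exact (norm_nonneg f).trans hM

lemma IsFourierL1.of_integrable {f : V → ℂ} (hf : Integrable f) {M : ℝ}
    (hM : ∫ x, ‖f x‖ ≤ M) : IsFourierL1 (𝓕 f) M := by
  have hf' : MemLp f 1 := memLp_one_iff_integrable.2 hf
  refine ⟨hf'.toLp, fun ξ => by rw [Real.fourierTransform_toLp], ?_⟩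
  rw [L1.norm_eq_integral_norm]
  refine le_of_eq_of_le (integral_congr_ae ?_) hM
  filter_upwards [hf'.coeFn_toLp] with x hx
  rw [hx]

lemma IsFourierL1.exists_integrable {u : V → ℂ} {M : ℝ} (h : IsFourierL1 u M) :
    ∃ f : V → ℂ, Integrable f ∧ 𝓕 f = u ∧ ∫ x, ‖f x‖ ≤ M := by
  obtain ⟨f, hf, hM⟩ := h
  refine ⟨f, L1.integrable_coeFn f, ?_, ?_⟩
  · ext ξ
    rw [← hf ξ, Real.Lp.fourierTransform_apply]
  · rwa [← L1.norm_eq_integral_norm]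

lemma IsFourierL1.norm_le {u : V → ℂ} {M : ℝ} (h : IsFourierL1 u M) (ξ : V) : ‖u ξ‖ ≤ M := by
  obtain ⟨f, hf, rfl, hM⟩ := h.exists_integrable
  exact (VectorFourier.norm_fourierIntegral_le_integral_norm _ _ _ _ _).trans hM

lemma IsFourierL1.add {u v : V → ℂ} {M N : ℝ} (hu : IsFourierL1 u M) (hv : IsFourierL1 v N) :
    IsFourierL1 (fun ξ => u ξ + v ξ) (M + N) := by
  obtain ⟨f, hf, hM⟩ := hu
  obtain ⟨g, hg, hN⟩ := hv
  refine ⟨f + g, fun ξ => ?_, (norm_add_le f g).trans (add_le_add hM hN)⟩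
  have := congrArg (fun F => F ξ) ((Real.Lp.fourierTransformCLM V ℂ).map_add f g)
  simpa only [Real.Lp.fourierTransformCLM_apply, BoundedContinuousFunction.coe_add, Pi.add_apply,
    hf, hg] using this

lemma IsFourierL1.const_mul {u : V → ℂ} {M : ℝ} (hu : IsFourierL1 u M) (c : ℂ) :
    IsFourierL1 (fun ξ => c * u ξ) (‖c‖ * M) := by
  obtain ⟨f, hf, hM⟩ := hu
  refine ⟨c • f, fun ξ => ?_, (norm_smul_le c f).trans (by gcongr)⟩
  have := congrArg (fun F => F ξ) ((Real.Lp.fourierTransformCLM V ℂ).map_smul c f)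
  simpa only [Real.Lp.fourierTransformCLM_apply, BoundedContinuousFunction.coe_smul,
    smul_eq_mul, hf] using this

/-- Products of transforms are transforms of convolutions, and the `L¹` norm is submultiplicative
under convolution. -/
lemma IsFourierL1.mul {u v : V → ℂ} {M N : ℝ} (hu : IsFourierL1 u M) (hv : IsFourierL1 v N) :
    IsFourierL1 (fun ξ => u ξ * v ξ) (M * N) := by
  have hM0 := hu.nonneg
  obtain ⟨f, hf, rfl, hM⟩ := hu.exists_integrable
  obtain ⟨g, hg, rfl, hN⟩ := hv.exists_integrable
  have hc : Integrable (f ⋆[ContinuousLinearMap.mul ℂ ℂ] g) := hf.integrable_convolution _ hg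
  have key : ∫ x, ‖(f ⋆[ContinuousLinearMap.mul ℂ ℂ] g) x‖ ≤ M * N := by
    have h1 : ∀ x, ‖(f ⋆[ContinuousLinearMap.mul ℂ ℂ] g) x‖ ≤
        ((fun x => ‖f x‖) ⋆[ContinuousLinearMap.mul ℝ ℝ] fun x => ‖g x‖) x := by
      intro x
      rw [convolution_def, convolution_def]
      refine (norm_integral_le_integral_norm _).trans (le_of_eq ?_)
      simp
    calc _ ≤ ∫ x, ((fun x => ‖f x‖) ⋆[ContinuousLinearMap.mul ℝ ℝ] fun x => ‖g x‖) x :=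
          integral_mono hc.norm (hf.norm.integrable_convolution _ hg.norm) h1
      _ = (∫ x, ‖f x‖) * ∫ x, ‖g x‖ := by
          rw [integral_convolution _ hf.norm hg.norm]; rfl
      _ ≤ M * N := by
          gcongr
  have := IsFourierL1.of_integrable hc key
  convert this using 1
  ext ξ
  rw [Real.fourier_mul_convolution_eq hf hg]

lemma IsFourierL1.pow_succ {u : V → ℂ} {M : ℝ} (hu : IsFourierL1 u M) (k : ℕ) :
    IsFourierL1 (fun ξ => u ξ ^ (k + 1)) (M ^ (k + 1)) := by
  induction k with
  | zero => simpa using hu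
  | succ k ih => simpa only [_root_.pow_succ _ (k + 1)] using ih.mul hu

/-- Completeness of `L¹` sums the preimages; evaluating the transform at a point is continuous on
`L¹`, which identifies the limit with the pointwise sum. -/
lemma IsFourierL1.hasSum {u : ℕ → V → ℂ} {M : ℕ → ℝ} {s : V → ℂ}
    (hu : ∀ k, IsFourierL1 (u k) (M k)) (hM : Summable M)
    (hs : ∀ ξ, HasSum (fun k => u k ξ) (s ξ)) : IsFourierL1 s (∑' k, M k) := by
  choose f hf hfM using hu
  have hsum : Summable fun k => ‖f k‖ := hM.of_nonneg_of_le (fun k => norm_nonneg _) hfM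
  refine ⟨∑' k, f k, fun ξ => ?_, ?_⟩
  · have h1 := (hsum.of_norm.hasSum.mapL (Real.Lp.fourierTransformCLM V ℂ)).mapL
      (BoundedContinuousFunction.evalCLM ℂ ξ)
    have h2 : HasSum (fun k => u k ξ) (Real.Lp.fourierTransform (∑' k, f k) ξ) := by
      simpa only [Real.Lp.fourierTransformCLM_apply, BoundedContinuousFunction.evalCLM_apply,
        hf] using h1
    exact h2.unique (hs ξ)
  · exact (norm_tsum_le_tsum_norm hsum).trans (hsum.tsum_le_tsum hfM hM)

/-- The `L¹` norm of the inverse Fourier transform is bounded by a Schwartz seminorm. -/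
lemma exists_isFourierL1_schwartz :
    ∃ (s : Finset (ℕ × ℕ)) (C : ℝ), 0 ≤ C ∧ ∀ (F : 𝓢(V, ℂ)) (B : ℝ), 0 ≤ B →
      (∀ p ∈ s, ∀ x, ‖x‖ ^ p.1 * ‖iteratedFDeriv ℝ p.2 F x‖ ≤ B) → IsFourierL1 F (C * B) := by
  -- Inverse transform followed by passage to the `L¹` class: a continuous linear map, hence bounded
  -- by finitely many Schwartz seminorms.
  let T : 𝓢(V, ℂ) →L[ℂ] Lp ℂ 1 (volume : Measure V) :=
    (SchwartzMap.toLpCLM ℂ ℂ 1 volume).comp (FourierTransform.fourierInvCLM ℂ 𝓢(V, ℂ))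
  obtain ⟨s, C, -, hC⟩ := Seminorm.bound_of_continuous (schwartz_withSeminorms ℂ V ℂ)
    ((normSeminorm ℂ _).comp T.toLinearMap) (continuous_norm.comp T.continuous)
  refine ⟨s, C, C.coe_nonneg, fun F B hB h => ⟨T F, fun ξ => ?_, ?_⟩⟩
  · have : T F = ((𝓕⁻ F).memLp 1).toLp := rfl
    rw [this, Real.fourierTransform_toLp, ← SchwartzMap.fourier_coe,
      FourierTransform.fourier_fourierInv_eq]
  · refine (hC F).trans ?_
    simp only [smul_apply, NNReal.smul_def, smul_eq_mul]
    gcongr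
    refine Seminorm.finset_sup_apply_le hB fun p hp => ?_
    exact SchwartzMap.seminorm_le_bound ℂ p.1 p.2 F hB (h p hp)

end FourierL1

/-! ### Derivatives of powers of a smooth function. -/

section DerivativeBounds

variable {V : Type*} [NormedAddCommGroup V] [NormedSpace ℝ V]

/-- A submultiplicative norm of the `N`-jet of `f` at `x`; it tends to `‖f x‖` as `t → 0`. -/
def jetNorm (t : ℝ) (N : ℕ) (f : V → ℂ) (x : V) : ℝ :=
  ∑ i ∈ Finset.range (N + 1), t ^ i / i.factorial * ‖iteratedFDeriv ℝ i f x‖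

lemma jetNorm_nonneg {t : ℝ} (ht : 0 ≤ t) (N : ℕ) (f : V → ℂ) (x : V) : 0 ≤ jetNorm t N f x :=
  Finset.sum_nonneg fun i _ => by positivity

/-- The weights `t ^ i / i!` turn the Leibniz rule into a Cauchy product; the full product of the
two truncated sums only adds nonnegative terms. -/
lemma jetNorm_mul_le {t : ℝ} (ht : 0 ≤ t) (N : ℕ) {f g : V → ℂ} (hf : ContDiff ℝ ∞ f)
    (hg : ContDiff ℝ ∞ g) (x : V) :
    jetNorm t N (fun y => f y * g y) x ≤ jetNorm t N f x * jetNorm t N g x := by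
  set A : ℕ → ℝ := fun i => t ^ i / i.factorial * ‖iteratedFDeriv ℝ i f x‖ with hA
  set B : ℕ → ℝ := fun i => t ^ i / i.factorial * ‖iteratedFDeriv ℝ i g x‖ with hB
  have hA0 : ∀ i, 0 ≤ A i := fun i => by positivity
  have hB0 : ∀ i, 0 ≤ B i := fun i => by positivity
  calc jetNorm t N (fun y => f y * g y) x
      ≤ ∑ n ∈ Finset.range (N + 1), ∑ i ∈ Finset.range (n + 1), A i * B (n - i) := by
        refine Finset.sum_le_sum fun n _ => ?_
        have h := norm_iteratedFDeriv_mul_le (n := n) hf hg x (by exact_mod_cast le_top)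
        refine (mul_le_mul_of_nonneg_left h (by positivity)).trans (le_of_eq ?_)
        rw [Finset.mul_sum]
        refine Finset.sum_congr rfl fun i hi => ?_
        have hin : i ≤ n := Nat.lt_succ_iff.1 (Finset.mem_range.1 hi)
        rw [Nat.cast_choose ℝ hin, hA, hB]
        have h1 : (n.factorial : ℝ) ≠ 0 := by positivity
        have h2 : (i.factorial : ℝ) ≠ 0 := by positivity
        have h3 : ((n - i).factorial : ℝ) ≠ 0 := by positivity
        have h4 : t ^ n = t ^ i * t ^ (n - i) := by rw [← pow_add, Nat.add_sub_cancel' hin]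
        rw [h4]
        field_simp
    _ = ∑ i ∈ Finset.range (N + 1), ∑ n ∈ Finset.Ico i (N + 1), A i * B (n - i) := by
        refine Finset.sum_comm' fun n i => ?_
        simp only [Finset.mem_range, Finset.mem_Ico]
        omega
    _ ≤ ∑ i ∈ Finset.range (N + 1), A i * ∑ n ∈ Finset.range (N + 1), B n := by
        refine Finset.sum_le_sum fun i _ => ?_
        rw [← Finset.mul_sum, Finset.sum_Ico_eq_sum_range]
        refine mul_le_mul_of_nonneg_left ?_ (hA0 i)
        simp only [Nat.add_sub_cancel_left]
        exact Finset.sum_le_sum_of_subset_of_nonneg (Finset.range_mono (by omega))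
          fun n _ _ => hB0 n
    _ = jetNorm t N f x * jetNorm t N g x := by rw [← Finset.sum_mul]; rfl

lemma jetNorm_one (t : ℝ) (N : ℕ) (x : V) : jetNorm t N (fun _ : V => (1 : ℂ)) x = 1 := by
  rw [jetNorm, Finset.sum_eq_single 0]
  · simp
  · intro i _ hi
    rw [iteratedFDeriv_const_of_ne hi]
    simp
  · simp

lemma jetNorm_pow_le {t : ℝ} (ht : 0 ≤ t) (N : ℕ) {f : V → ℂ} (hf : ContDiff ℝ ∞ f) (x : V)
    (k : ℕ) : jetNorm t N (fun y => f y ^ k) x ≤ jetNorm t N f x ^ k := by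
  induction k with
  | zero => simpa using (jetNorm_one t N x).le
  | succ k ih =>
    simp only [pow_succ]
    exact (jetNorm_mul_le ht N (hf.pow k) hf x).trans
      (mul_le_mul_of_nonneg_right ih (jetNorm_nonneg ht N f x))

lemma norm_iteratedFDeriv_const_le (c : ℂ) (j : ℕ) (x : V) :
    ‖iteratedFDeriv ℝ j (fun _ : V => c) x‖ ≤ ‖c‖ := by
  rcases eq_or_ne j 0 with rfl | hj
  · simp
  · rw [iteratedFDeriv_const_of_ne hj]
    simp

lemma exists_bound_iteratedFDeriv {u : V → ℂ} (hu : ContDiff ℝ ∞ u) (hc : HasCompactSupport u)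
    (N : ℕ) : ∃ D : ℝ, 0 ≤ D ∧ ∀ j ≤ N, ∀ x, ‖iteratedFDeriv ℝ j u x‖ ≤ D := by
  have h : ∀ j, ∃ D : ℝ, ∀ x, ‖iteratedFDeriv ℝ j u x‖ ≤ D := fun j =>
    (hc.iteratedFDeriv j).exists_bound_of_continuous
      (hu.continuous_iteratedFDeriv (by exact_mod_cast le_top))
  choose D hD using h
  refine ⟨∑ j ∈ Finset.range (N + 1), |D j|, by positivity, fun j hj x => (hD j x).trans ?_⟩
  exact (le_abs_self _).trans (Finset.single_le_sum (f := fun j => |D j|)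
    (fun i _ => abs_nonneg _) (Finset.mem_range.2 (by omega)))

lemma norm_iteratedFDeriv_add_const_le {u : V → ℂ} (hu : ContDiff ℝ ∞ u) (c : ℂ) (j : ℕ) (x : V) :
    ‖iteratedFDeriv ℝ j (fun y => u y + c) x‖ ≤ ‖iteratedFDeriv ℝ j u x‖ + ‖c‖ := by
  have : iteratedFDeriv ℝ j (fun y => u y + c) x =
      iteratedFDeriv ℝ j u x + iteratedFDeriv ℝ j (fun _ => c) x :=
    iteratedFDeriv_add_apply (f := u) (g := fun _ => c)
      (hu.contDiffAt.of_le (by exact_mod_cast le_top)) contDiffAt_const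
  rw [this]
  exact (norm_add_le _ _).trans (by gcongr; exact norm_iteratedFDeriv_const_le c j x)

/-- The derivatives of the powers of `v` grow at most like `q ^ k`, for every `q > sup ‖v‖`. -/
lemma exists_bound_iteratedFDeriv_pow {v : V → ℂ} (hv : ContDiff ℝ ∞ v)
    (hc : HasCompactSupport fun x => v x - 1) {q₀ q : ℝ} (hq₀ : ∀ x, ‖v x‖ ≤ q₀) (hq : q₀ < q)
    (N : ℕ) : ∃ C : ℝ, 0 ≤ C ∧ ∀ k : ℕ, ∀ j ≤ N, ∀ x,
      ‖iteratedFDeriv ℝ j (fun y => v y ^ k) x‖ ≤ C * q ^ k := by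
  have hq0 : 0 ≤ q₀ := (norm_nonneg _).trans (hq₀ 0)
  obtain ⟨D, hD0, hD⟩ := exists_bound_iteratedFDeriv (hv.sub contDiff_const) hc N
  have hD' : ∀ j ≤ N, ∀ x, ‖iteratedFDeriv ℝ j v x‖ ≤ D + 1 := by
    intro j hj x
    have := norm_iteratedFDeriv_add_const_le (u := fun y => v y - 1) (hv.sub contDiff_const) 1 j x
    simp only [sub_add_cancel, norm_one] at this
    exact this.trans (by gcongr; exact hD j hj x)
  -- The order-zero term of the jet norm is at most `q₀`, and each of the `N` others at most `t * (D
  -- + 1)`; this `t` keeps the total below `q`.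
  set t : ℝ := min 1 ((q - q₀) / (N * (D + 1) + 1)) with ht
  have ht0 : 0 < t := lt_min one_pos (div_pos (by linarith) (by positivity))
  have ht1 : t ≤ 1 := min_le_left _ _
  have htq : N * (t * (D + 1)) ≤ q - q₀ := by
    have : t * (N * (D + 1) + 1) ≤ q - q₀ :=
      (le_div_iff₀ (by positivity)).1 (min_le_right _ _)
    nlinarith
  have hjet : ∀ x, jetNorm t N v x ≤ q := by
    intro x
    rw [jetNorm, Finset.sum_range_succ']
    have h0 : t ^ 0 / (Nat.factorial 0 : ℝ) * ‖iteratedFDeriv ℝ 0 v x‖ ≤ q₀ := by simpa using hq₀ x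
    have h1 : ∑ i ∈ Finset.range N,
        t ^ (i + 1) / ((i + 1).factorial : ℝ) * ‖iteratedFDeriv ℝ (i + 1) v x‖ ≤
        ∑ i ∈ Finset.range N, t * (D + 1) := by
      refine Finset.sum_le_sum fun i hi => ?_
      have hle : t ^ (i + 1) / ((i + 1).factorial : ℝ) ≤ t := by
        rw [div_le_iff₀ (by positivity)]
        calc t ^ (i + 1) ≤ t ^ 1 := pow_le_pow_of_le_one ht0.le ht1 (by omega)
          _ = t * 1 := by ring
          _ ≤ t * ((i + 1).factorial : ℝ) := by
            gcongr
            exact_mod_cast Nat.succ_le_of_lt (Nat.factorial_pos _)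
      have := hD' (i + 1) (by have := Finset.mem_range.1 hi; omega) x
      gcongr
    rw [Finset.sum_const, Finset.card_range, nsmul_eq_mul] at h1
    linarith
  -- This constant undoes the weight `t ^ j / j!` for all `j ≤ N` at once, as `t ≤ 1`.
  refine ⟨N.factorial / t ^ N, by positivity, fun k j hj x => ?_⟩
  have h1 : t ^ j / j.factorial * ‖iteratedFDeriv ℝ j (fun y => v y ^ k) x‖ ≤ q ^ k :=
    calc _ ≤ jetNorm t N (fun y => v y ^ k) x :=
          Finset.single_le_sum
            (f := fun i => t ^ i / (i.factorial : ℝ) * ‖iteratedFDeriv ℝ i (fun y => v y ^ k) x‖)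
            (fun i _ => by positivity) (Finset.mem_range.2 (by omega))
      _ ≤ jetNorm t N v x ^ k := jetNorm_pow_le ht0.le N hv x k
      _ ≤ q ^ k := pow_le_pow_left₀ (jetNorm_nonneg ht0.le N v x) (hjet x) k
  have h2 : (1 : ℝ) ≤ N.factorial / t ^ N * (t ^ j / j.factorial) := by
    rw [div_mul_div_comm, one_le_div (by positivity), mul_comm (N.factorial : ℝ)]
    exact mul_le_mul (pow_le_pow_of_le_one ht0.le ht1 hj)
      (by exact_mod_cast Nat.factorial_le hj) (by positivity) (by positivity)
  calc ‖iteratedFDeriv ℝ j (fun y => v y ^ k) x‖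
      = 1 * ‖iteratedFDeriv ℝ j (fun y => v y ^ k) x‖ := (one_mul _).symm
    _ ≤ (N.factorial / t ^ N * (t ^ j / j.factorial)) *
        ‖iteratedFDeriv ℝ j (fun y => v y ^ k) x‖ := by gcongr
    _ ≤ N.factorial / t ^ N * q ^ k := by rw [mul_assoc]; gcongr

end DerivativeBounds

/-! ### Smooth compactly supported functions in the Fourier algebra. -/

section Approximation

variable {V : Type*} [NormedAddCommGroup V] [InnerProductSpace ℝ V] [FiniteDimensional ℝ V]
  [MeasurableSpace V] [BorelSpace V]

/-- On a fixed ball, the `L¹` norm of the inverse Fourier transform is bounded by finitely many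
derivatives. -/
lemma exists_isFourierL1_of_compactSupport {K : Set V} (hK : IsCompact K) :
    ∃ (N : ℕ) (C : ℝ), 0 ≤ C ∧ ∀ (F : V → ℂ), ContDiff ℝ ∞ F → tsupport F ⊆ K →
      ∀ B : ℝ, 0 ≤ B → (∀ j ≤ N, ∀ x, ‖iteratedFDeriv ℝ j F x‖ ≤ B) → IsFourierL1 F (C * B) := by
  obtain ⟨s, C, hC, h⟩ := exists_isFourierL1_schwartz (V := V)
  obtain ⟨R, hR1, hR⟩ : ∃ R : ℝ, 1 ≤ R ∧ ∀ x ∈ K, ‖x‖ ≤ R := by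
    obtain ⟨R, hR⟩ := hK.isBounded.exists_norm_le
    exact ⟨max 1 R, le_max_left _ _, fun x hx => (hR x hx).trans (le_max_right _ _)⟩
  refine ⟨s.sup Prod.snd, C * R ^ (s.sup Prod.fst), by positivity, fun F hF hs B hB hd => ?_⟩
  have hc : HasCompactSupport F := hK.of_isClosed_subset (isClosed_tsupport F) hs
  have := h (hc.toSchwartzMap hF) (R ^ (s.sup Prod.fst) * B) (by positivity) fun p hp x => by
    by_cases hx : x ∈ K
    · have h1 : ‖x‖ ^ p.1 ≤ R ^ (s.sup Prod.fst) :=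
        (pow_le_pow_left₀ (norm_nonneg _) (hR x hx) _).trans
          (pow_le_pow_right₀ hR1 (Finset.le_sup (f := Prod.fst) hp))
      have h2 := hd p.2 (Finset.le_sup (f := Prod.snd) hp) x
      exact mul_le_mul h1 h2 (norm_nonneg _) (by positivity)
    · have h0 : iteratedFDeriv ℝ p.2 F x = 0 := by
        by_contra hne
        exact hx (hs (support_iteratedFDeriv_subset p.2 hne))
      have h0' : iteratedFDeriv ℝ p.2 (hc.toSchwartzMap hF) x = 0 := h0
      rw [h0', norm_zero, mul_zero]
      positivity
  rw [mul_assoc]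
  exact this

lemma isFourierL1_of_contDiff {F : V → ℂ} (hF : ContDiff ℝ ∞ F) (hc : HasCompactSupport F) :
    ∃ M, IsFourierL1 F M := by
  obtain ⟨N, C, -, h⟩ := exists_isFourierL1_of_compactSupport hc.isCompact
  obtain ⟨D, hD0, hD⟩ := exists_bound_iteratedFDeriv hF hc N
  exact ⟨_, h F hF subset_rfl D hD0 hD⟩

/-- The powers of `1 / (1 + u)` grow in the Fourier algebra at most like `q ^ k`, for every
`q > sup |1 / (1 + u)|`. -/
lemma exists_isFourierL1_inv_pow {u : V → ℂ} (hu : ContDiff ℝ ∞ u) (hc : HasCompactSupport u)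
    {m q : ℝ} (hm : 0 < m) (hmu : ∀ x, m ≤ ‖1 + u x‖) (hq : m⁻¹ < q) (hq1 : 1 ≤ q) :
    ∃ C : ℝ, 0 ≤ C ∧ ∀ k : ℕ, IsFourierL1 (fun x => ((1 + u x)⁻¹) ^ k - 1) (C * q ^ k) := by
  have hne : ∀ x, 1 + u x ≠ 0 := fun x => norm_pos_iff.1 (hm.trans_le (hmu x))
  have hv : ContDiff ℝ ∞ fun x => (1 + u x)⁻¹ := (contDiff_const.add hu).inv hne
  have hvc : HasCompactSupport fun x => (1 + u x)⁻¹ - 1 :=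
    hc.comp_left (g := fun w : ℂ => (1 + w)⁻¹ - 1) (by simp)
  obtain ⟨N, C₁, hC₁, h⟩ := exists_isFourierL1_of_compactSupport hc.isCompact
  obtain ⟨C₂, hC₂, h'⟩ := exists_bound_iteratedFDeriv_pow hv hvc (q₀ := m⁻¹) (q := q)
    (fun x => by rw [norm_inv]; exact inv_anti₀ hm (hmu x)) hq N
  refine ⟨C₁ * (C₂ + 1), by positivity, fun k => ?_⟩
  rw [mul_assoc]
  refine h _ ((hv.pow k).sub contDiff_const) ?_ _ (by positivity) fun j hj x => ?_
  · refine closure_mono fun x hx => ?_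
    contrapose! hx
    simp only [Function.mem_support, not_not] at hx ⊢
    simp [hx]
  · have h1 := norm_iteratedFDeriv_add_const_le (hv.pow k) (-1) j x
    simp only [norm_neg, norm_one, ← sub_eq_add_neg] at h1
    refine h1.trans ?_
    rw [add_mul]
    -- The assumption `1 ≤ q` lets the subtracted constant be absorbed into `q ^ k`.
    exact add_le_add (h' k j hj x) (by rw [one_mul]; exact one_le_pow₀ hq1)

/-- Every Schwartz function is approximated by smooth functions of compact support. -/
lemma exists_compactSupport_approx_schwartz (F : 𝓢(V, ℂ)) {ε : ℝ} (hε : 0 < ε) :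
    ∃ u : V → ℂ, ContDiff ℝ ∞ u ∧ HasCompactSupport u ∧ IsFourierL1 (fun x => F x - u x) ε := by
  obtain ⟨s, C, hC, h⟩ := exists_isFourierL1_schwartz (V := V)
  let χ : ContDiffBump (0 : V) := ⟨1, 2, one_pos, one_lt_two⟩
  let θ : V → ℂ := fun x => (χ x : ℂ)
  have hθ : ContDiff ℝ ∞ θ := Complex.ofRealCLM.contDiff.comp χ.contDiff
  have hθc : HasCompactSupport θ := χ.hasCompactSupport.comp_left (g := Complex.ofReal) (by simp)
  -- Cutting off with `θ (t • y)` changes each seminorm by `O(t)`. The error vanishes where `t * ‖x‖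
  -- < 1`; elsewhere `1 ≤ t * ‖x‖`, so one extra power of decay of `F` (hence `a + 1` below) pays
  -- for the factor `t`.
  have key : ∀ p : ℕ × ℕ, ∃ K : ℝ, 0 ≤ K ∧ ∀ t : ℝ, 0 < t → t ≤ 1 → ∀ x,
      ‖x‖ ^ p.1 * ‖iteratedFDeriv ℝ p.2 (fun y => (1 - θ (t • y)) * F y) x‖ ≤ t * K := by
    rintro ⟨a, b⟩
    obtain ⟨D, hD0, hD⟩ := exists_bound_iteratedFDeriv hθ hθc b
    choose S hS0 hS using fun j => F.decay (a + 1) j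
    refine ⟨∑ i ∈ Finset.range (b + 1), (b.choose i : ℝ) * (D + 1) * S (b - i),
      Finset.sum_nonneg fun i _ => mul_nonneg (by positivity) (hS0 _).le, fun t ht ht1 x => ?_⟩
    have hψ : ContDiff ℝ ∞ fun y => 1 - θ y := contDiff_const.sub hθ
    have hψt : ContDiff ℝ ∞ fun y => 1 - θ (t • y) := hψ.comp (contDiff_const_smul t)
    rcases lt_or_ge (t * ‖x‖) 1 with hx | hx
    · have hev : (fun y => (1 - θ (t • y)) * F y) =ᶠ[𝓝 x] fun _ => 0 := by
        have : ∀ᶠ y in 𝓝 x, t * ‖y‖ < 1 :=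
          (continuous_const.mul continuous_norm).continuousAt.eventually_lt_const hx
        filter_upwards [this] with y hy
        have : χ (t • y) = 1 := χ.one_of_mem_closedBall <| by
          rw [mem_closedBall_zero_iff, norm_smul, Real.norm_of_nonneg ht.le]
          exact hy.le
        simp [θ, this]
      have h0 : ‖iteratedFDeriv ℝ b (fun y => (1 - θ (t • y)) * F y) x‖ ≤ 0 := by
        rw [(hev.iteratedFDeriv ℝ b).eq_of_nhds]
        simp
      calc _ ≤ ‖x‖ ^ a * 0 := by gcongr
        _ ≤ _ := by
          rw [mul_zero]
          exact mul_nonneg ht.le (Finset.sum_nonneg fun i _ =>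
            mul_nonneg (by positivity) (hS0 _).le)
    · have hder : ∀ i ≤ b, ‖iteratedFDeriv ℝ i (fun y => 1 - θ (t • y)) x‖ ≤ D + 1 := by
        intro i hi
        rw [iteratedFDeriv_comp_const_smul (i := i) (f := fun y => 1 - θ y) t
          (hψ.of_le (by exact_mod_cast le_top)), norm_smul, norm_pow, Real.norm_of_nonneg ht.le]
        have h1 := norm_iteratedFDeriv_add_const_le hθ.neg 1 i (t • x)
        have h2 : (fun y => 1 - θ y) = fun y => -θ y + 1 := by ext y; ring
        have h3 : ‖iteratedFDeriv ℝ i (fun y => -θ y) (t • x)‖ =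
            ‖iteratedFDeriv ℝ i θ (t • x)‖ := by
          have : (fun y => -θ y) = -θ := rfl
          rw [this, iteratedFDeriv_neg]
          simp
        rw [h2]
        have h4 := hD i hi (t • x)
        rw [h3, norm_one] at h1
        calc _ ≤ 1 * (D + 1) :=
              mul_le_mul (pow_le_one₀ ht.le ht1) (h1.trans (by gcongr)) (norm_nonneg _) zero_le_one
          _ = D + 1 := one_mul _
      calc ‖x‖ ^ a * ‖iteratedFDeriv ℝ b (fun y => (1 - θ (t • y)) * F y) x‖
          ≤ (‖x‖ ^ a * (t * ‖x‖)) * ∑ i ∈ Finset.range (b + 1), (b.choose i : ℝ) *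
              ‖iteratedFDeriv ℝ i (fun y => 1 - θ (t • y)) x‖ *
              ‖iteratedFDeriv ℝ (b - i) F x‖ := by
            gcongr
            · exact le_mul_of_one_le_right (by positivity) hx
            · exact norm_iteratedFDeriv_mul_le hψt (F.smooth ⊤) x (by exact_mod_cast le_top)
        _ = t * ∑ i ∈ Finset.range (b + 1), (b.choose i : ℝ) *
              ‖iteratedFDeriv ℝ i (fun y => 1 - θ (t • y)) x‖ *
              (‖x‖ ^ (a + 1) * ‖iteratedFDeriv ℝ (b - i) F x‖) := by
            rw [Finset.mul_sum, Finset.mul_sum]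
            refine Finset.sum_congr rfl fun i _ => ?_
            ring
        _ ≤ _ := by
            gcongr with i hi
            · exact hder i (Nat.lt_succ_iff.1 (Finset.mem_range.1 hi))
            · exact hS (b - i) x
  choose K hK0 hK using key
  set M : ℝ := ∑ p ∈ s, K p with hM
  have hM0 : 0 ≤ M := Finset.sum_nonneg fun p _ => hK0 p
  set t : ℝ := min 1 (ε / (C * M + 1)) with ht
  have ht0 : 0 < t := lt_min one_pos (by positivity)
  have ht1 : t ≤ 1 := min_le_left _ _
  have hθt : ContDiff ℝ ∞ fun y => θ (t • y) := hθ.comp (contDiff_const_smul t)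
  have hu : ContDiff ℝ ∞ fun y => θ (t • y) * F y := hθt.mul (F.smooth ⊤)
  have huc : HasCompactSupport fun y => θ (t • y) * F y :=
    (hθc.comp_homeomorph (Homeomorph.smulOfNeZero t ht0.ne')).mul_right
  refine ⟨_, hu, huc, ?_⟩
  have hG : (fun y => (1 - θ (t • y)) * F y) = ⇑(F - huc.toSchwartzMap hu) := by
    ext y
    simp only [sub_apply, HasCompactSupport.toSchwartzMap_toFun]
    ring
  have hle : C * (t * M) ≤ ε := by
    have : t * (C * M + 1) ≤ ε := (le_div_iff₀ (by positivity)).1 (min_le_right _ _)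
    nlinarith
  exact (h (F - huc.toSchwartzMap hu) (t * M) (by positivity) fun p hp x => by
    rw [← hG]
    refine (hK p t ht0 ht1 x).trans ?_
    gcongr
    exact Finset.single_le_sum (f := K) (fun p _ => hK0 p) hp).mono hle

/-- Smooth functions of compact support are dense in the Fourier algebra. -/
lemma exists_compactSupport_approx {f : V → ℂ} (hf : Integrable f) {ε : ℝ} (hε : 0 < ε) :
    ∃ u : V → ℂ, ContDiff ℝ ∞ u ∧ HasCompactSupport u ∧
      IsFourierL1 (fun x => 𝓕 f x - u x) ε := by
  have hf' : MemLp f 1 := memLp_one_iff_integrable.2 hf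
  obtain ⟨φ, hφ⟩ := (SchwartzMap.denseRange_toLpCLM (E := V) (F := ℂ) (p := 1)
    (μ := volume) (by simp)).exists_dist_lt hf'.toLp (half_pos hε)
  -- The cutoff acts on the transform side, so it is applied to `𝓕 φ`, which is again Schwartz.
  obtain ⟨u, hu, huc, huF⟩ := exists_compactSupport_approx_schwartz (𝓕 φ) (half_pos hε)
  refine ⟨u, hu, huc, ?_⟩
  have h1 : IsFourierL1 (fun x => 𝓕 f x - 𝓕 φ x) (ε / 2) := by
    refine ⟨hf'.toLp - φ.toLp 1 volume, fun ξ => ?_, ?_⟩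
    · have := congrArg (fun F => F ξ)
        ((Real.Lp.fourierTransformCLM V ℂ).map_sub hf'.toLp (φ.toLp 1 volume))
      simp only [Real.Lp.fourierTransformCLM_apply, BoundedContinuousFunction.coe_sub,
        Pi.sub_apply] at this
      rw [this, Real.fourierTransform_toLp, SchwartzMap.toLp, Real.fourierTransform_toLp]
      rfl
    · rw [← dist_eq_norm]
      exact hφ.le
  have := h1.add huF
  simpa using this

end Approximation

/-! ### Compactly supported logarithms in dimension at least two. -/

section Logarithm

variable {V : Type*} [NormedAddCommGroup V] [NormedSpace ℝ V]

/-- Polar coordinates: the exterior is a continuous image of `(R, ∞)` times the unit sphere, which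
is connected in dimension at least two. -/
lemma isPreconnected_compl_closedBall (h : 1 < Module.rank ℝ V) {R : ℝ} (hR : 0 ≤ R) :
    IsPreconnected (Metric.closedBall (0 : V) R)ᶜ := by
  have h1 : IsPreconnected (Ioi R ×ˢ Metric.sphere (0 : V) 1) :=
    isPreconnected_Ioi.prod (isPreconnected_sphere h 0 1)
  have h2 : (Metric.closedBall (0 : V) R)ᶜ =
      (fun p : ℝ × V => p.1 • p.2) '' (Ioi R ×ˢ Metric.sphere (0 : V) 1) := by
    ext x
    simp only [mem_compl_iff, mem_closedBall_zero_iff, not_le, mem_image, mem_prod, mem_Ioi,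
      mem_sphere_zero_iff_norm, Prod.exists]
    constructor
    · intro hx
      have hx0 : ‖x‖ ≠ 0 := (hR.trans_lt hx).ne'
      exact ⟨‖x‖, ‖x‖⁻¹ • x, ⟨hx, by rw [norm_smul, norm_inv, norm_norm, inv_mul_cancel₀ hx0]⟩,
        smul_inv_smul₀ hx0 x⟩
    · rintro ⟨r, y, ⟨hr, hy⟩, rfl⟩
      rwa [norm_smul, hy, mul_one, Real.norm_of_nonneg (hR.trans hr.le)]
  rw [h2]
  exact h1.image _ (by fun_prop)

/-- A continuous logarithm of a smooth function is smooth. -/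
lemma contDiff_of_exp {L w : V → ℂ} (hL : Continuous L) (hw : ContDiff ℝ ∞ w)
    (h : ∀ x, Complex.exp (L x) = w x) : ContDiff ℝ ∞ L := by
  rw [contDiff_iff_contDiffAt]
  intro x₀
  -- By continuity the imaginary part of `L x - L x₀` stays in `(-π, π)` near `x₀`, where the
  -- principal branch inverts `exp`.
  have hloc : L =ᶠ[𝓝 x₀] fun x => L x₀ + Complex.log (w x * Complex.exp (-L x₀)) := by
    have hlim : Tendsto (fun x => (L x - L x₀).im) (𝓝 x₀) (𝓝 0) := by
      have : Continuous fun x => (L x - L x₀).im := by fun_prop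
      simpa using this.tendsto x₀
    have hev := hlim.eventually (Ioo_mem_nhds (neg_lt_zero.2 Real.pi_pos) Real.pi_pos)
    filter_upwards [hev] with x hx
    rw [← h x, ← Complex.exp_add, ← sub_eq_add_neg, Complex.log_exp hx.1 hx.2.le]
    ring
  refine ContDiffAt.congr_of_eventuallyEq ?_ hloc
  have hmem : w x₀ * Complex.exp (-L x₀) ∈ Complex.slitPlane := by
    rw [← h x₀, ← Complex.exp_add, add_neg_cancel, Complex.exp_zero]
    exact Complex.one_mem_slitPlane
  have hlog : ContDiffAt ℝ ∞ Complex.log (w x₀ * Complex.exp (-L x₀)) :=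
    (Complex.contDiffAt_log hmem).restrict_scalars ℝ
  exact contDiffAt_const.add (hlog.comp x₀ (f := fun x => w x * Complex.exp (-L x₀))
    (hw.contDiffAt.mul contDiffAt_const))

/-- In dimension at least two, a nonvanishing function `1 + u` with `u` smooth and compactly
supported has a smooth and compactly supported logarithm. -/
lemma exists_compactSupport_log [ProperSpace V] (hV : 1 < Module.rank ℝ V) {u : V → ℂ}
    (hu : ContDiff ℝ ∞ u)
    (hc : HasCompactSupport u) (hne : ∀ x, 1 + u x ≠ 0) :
    ∃ L : V → ℂ, ContDiff ℝ ∞ L ∧ HasCompactSupport L ∧ ∀ x, Complex.exp (L x) = 1 + u x := by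
  have hV' : Nontrivial V := by
    by_contra hn
    have := not_nontrivial_iff_subsingleton.1 hn
    simp at hV
  obtain ⟨L₀, hL₀c, hL₀⟩ := Complex.exists_continuousOn_eqOn_exp_comp (X := V) (U := univ)
    (g := fun x => 1 + u x)
    ((Homeomorph.Set.univ V).toHomotopyEquiv.simplyConnectedSpace_iff.2 inferInstance) isOpen_univ
    (continuous_const.add hu.continuous).continuousOn (by rintro ⟨x, -, hx⟩; exact hne x hx)
  rw [continuousOn_univ] at hL₀c
  have hL₀e : ∀ x, Complex.exp (L₀ x) = 1 + u x := fun x => hL₀ (mem_univ x)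
  obtain ⟨R, hR0, hR⟩ : ∃ R : ℝ, 0 ≤ R ∧ ∀ x ∈ tsupport u, ‖x‖ ≤ R := by
    obtain ⟨R, hR⟩ := hc.isCompact.isBounded.exists_norm_le
    exact ⟨max 0 R, le_max_left _ _, fun x hx => (hR x hx).trans (le_max_right _ _)⟩
  have hu0 : ∀ x, R < ‖x‖ → u x = 0 := fun x hx =>
    image_eq_zero_of_notMem_tsupport fun h => (hR x h).not_gt hx
  obtain ⟨x₁, hx₁⟩ := NormedSpace.exists_lt_norm ℝ V R
  have hx₁e : Complex.exp (L₀ x₁) = 1 := by rw [hL₀e, hu0 x₁ hx₁, add_zero]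
  -- Outside the ball both functions lift the constant `1` through the covering `exp` and agree at
  -- `x₁`; uniqueness of lifts on a connected set applies.
  have hconst : EqOn L₀ (fun _ => L₀ x₁) (Metric.closedBall (0 : V) R)ᶜ := by
    refine Complex.isCoveringMap_exp.eqOn_of_comp_eqOn (isPreconnected_compl_closedBall hV hR0)
      hL₀c.continuousOn continuousOn_const (fun x hx => ?_) (a := x₁) (by simpa using hx₁) rfl
    have hx' : R < ‖x‖ := by simpa using hx
    simp [hL₀e, hu0 x hx', hu0 x₁ hx₁]
  have hexp : ∀ x, Complex.exp (L₀ x - L₀ x₁) = 1 + u x := fun x => by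
    rw [Complex.exp_sub, hx₁e, div_one, hL₀e]
  refine ⟨fun x => L₀ x - L₀ x₁, contDiff_of_exp (hL₀c.sub continuous_const)
    (contDiff_const.add hu) hexp, ?_, hexp⟩
  refine HasCompactSupport.intro (isCompact_closedBall (0 : V) R) fun x hx => ?_
  exact sub_eq_zero.2 (hconst hx)

end Logarithm

/-! ### The Wiener–Lévy theorem for the logarithm. -/

section WienerLevy

variable {V : Type*} [NormedAddCommGroup V] [InnerProductSpace ℝ V] [FiniteDimensional ℝ V]
  [MeasurableSpace V] [BorelSpace V]

/-- By Riemann–Lebesgue `1 + 𝓕 f` is close to `1` outside a compact set, on which the continuous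
modulus has a positive lower bound. -/
lemma exists_pos_le_norm_one_add_fourier {f : V → ℂ} (hf : Integrable f)
    (hne : ∀ ξ, 1 + 𝓕 f ξ ≠ 0) : ∃ m : ℝ, 0 < m ∧ m ≤ 1 ∧ ∀ ξ, m ≤ ‖1 + 𝓕 f ξ‖ := by
  have hcont : Continuous (𝓕 f) := VectorFourier.fourierIntegral_continuous
    Real.continuous_fourierChar (innerSL ℝ).continuous₂ hf
  have hlim : Tendsto (𝓕 f) (cocompact V) (𝓝 0) :=
    tendsto_integral_exp_inner_smul_cocompact f
  have hev : ∀ᶠ ξ in cocompact V, 1 / 2 ≤ ‖1 + 𝓕 f ξ‖ := by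
    have h1 : Tendsto (fun ξ => ‖1 + 𝓕 f ξ‖) (cocompact V) (𝓝 1) := by
      simpa using (hlim.const_add 1).norm
    exact h1.eventually_const_le (by norm_num)
  obtain ⟨K, hK, hKm⟩ := mem_cocompact.1 hev
  obtain ⟨m, hm, hmK⟩ := hK.exists_forall_le' (f := fun ξ => ‖1 + 𝓕 f ξ‖) (a := 0)
    (by fun_prop) (fun ξ _ => norm_pos_iff.2 (hne ξ))
  refine ⟨min m (1 / 2), lt_min hm (by norm_num), (min_le_right _ _).trans (by norm_num),
    fun ξ => ?_⟩
  by_cases hξ : ξ ∈ K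
  · exact (min_le_left _ _).trans (hmK ξ hξ)
  · exact (min_le_right _ _).trans (hKm hξ)

/-- **Wiener–Lévy theorem** for the logarithm, in dimension at least two. -/
theorem exists_exp_fourier_eq (hV : 1 < Module.rank ℝ V) {f : V → ℂ} (hf : Integrable f)
    (hne : ∀ ξ, 1 + 𝓕 f ξ ≠ 0) :
    ∃ g : V → ℂ, Integrable g ∧ ∀ ξ, Complex.exp (𝓕 g ξ) = 1 + 𝓕 f ξ := by
  obtain ⟨m, hm, hm1, hmf⟩ := exists_pos_le_norm_one_add_fourier hf hne
  -- With error `m / 4`, `|1 + u| ≥ 3m/4`, so powers of the inverse grow at most like `(2 / m) ^ k`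
  -- because `4 / (3m) < 2 / m`; and `(m / 4) * (2 / m) = 1 / 2` gives a convergent geometric
  -- series.
  obtain ⟨u, hu, huc, hfu⟩ := exists_compactSupport_approx hf (show 0 < m / 4 by positivity)
  have hmu : ∀ ξ, 3 / 4 * m ≤ ‖1 + u ξ‖ := by
    intro ξ
    have h1 := hfu.norm_le ξ
    have h2 : ‖1 + 𝓕 f ξ‖ ≤ ‖1 + u ξ‖ + ‖𝓕 f ξ - u ξ‖ := by
      refine le_of_eq_of_le ?_ (norm_add_le _ _)
      congr 1
      ring
    linarith [hmf ξ]
  have hune : ∀ ξ, 1 + u ξ ≠ 0 := fun ξ => norm_pos_iff.1 (lt_of_lt_of_le (by positivity) (hmu ξ))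
  obtain ⟨L, hL, hLc, hLu⟩ := exists_compactSupport_log hV hu huc hune
  obtain ⟨M, hLM⟩ := isFourierL1_of_contDiff hL hLc
  obtain ⟨C, hC, hinv⟩ := exists_isFourierL1_inv_pow hu huc (m := 3 / 4 * m) (q := 2 / m)
    (by positivity) hmu
    (by rw [mul_inv, div_eq_mul_inv]; exact mul_lt_mul_of_pos_right (by norm_num) (inv_pos.2 hm))
    (by rw [one_le_div hm]; linarith)
  set h : V → ℂ := fun ξ => (𝓕 f ξ - u ξ) * (1 + u ξ)⁻¹ with hh
  have hpow : ∀ k : ℕ, IsFourierL1 (fun ξ => h ξ ^ (k + 1))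
      ((1 / 4) ^ (k + 1) + C * (1 / 2) ^ (k + 1)) := by
    intro k
    have h1 := hfu.pow_succ k
    have h2 := h1.add (h1.mul (hinv (k + 1)))
    -- The constant `1` is not in the Fourier algebra, so the power of the inverse is split as `1`
    -- plus an element of the algebra.
    have h3 : (fun ξ => h ξ ^ (k + 1)) = fun ξ => (𝓕 f ξ - u ξ) ^ (k + 1) +
        (𝓕 f ξ - u ξ) ^ (k + 1) * ((1 + u ξ)⁻¹ ^ (k + 1) - 1) := by
      ext ξ
      simp only [hh, mul_pow]
      ring
    rw [h3]
    refine h2.mono ?_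
    have h4 : (m / 4) ^ (k + 1) ≤ (1 / 4) ^ (k + 1) := by gcongr
    have h5 : (m / 4) ^ (k + 1) * (C * (2 / m) ^ (k + 1)) = C * (1 / 2) ^ (k + 1) := by
      rw [mul_left_comm, ← mul_pow]
      congr 2
      field_simp
      norm_num
    rw [h5]
    gcongr
  have hterm : ∀ k : ℕ, IsFourierL1
      (fun ξ => (-1) ^ (k + 1 + 1) * h ξ ^ (k + 1) / ((k + 1 : ℕ) : ℂ))
      ((1 / 4) ^ (k + 1) + C * (1 / 2) ^ (k + 1)) := by
    intro k
    have h1 := (hpow k).const_mul ((-1) ^ (k + 1 + 1) / ((k + 1 : ℕ) : ℂ))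
    have h2 : (fun ξ => (-1) ^ (k + 1 + 1) * h ξ ^ (k + 1) / ((k + 1 : ℕ) : ℂ)) =
        fun ξ => (-1) ^ (k + 1 + 1) / ((k + 1 : ℕ) : ℂ) * h ξ ^ (k + 1) := by
      ext ξ; ring
    rw [h2]
    refine h1.mono (mul_le_of_le_one_left (hpow k).nonneg ?_)
    rw [norm_div, norm_pow, norm_neg, norm_one, one_pow, Complex.norm_natCast]
    exact div_le_one_of_le₀ (by norm_cast; omega) (by positivity)
  have hh1 : ∀ ξ, ‖h ξ‖ < 1 := by
    intro ξ
    rw [hh, norm_mul, norm_inv, ← div_eq_mul_inv,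
      div_lt_one (lt_of_lt_of_le (by positivity) (hmu ξ))]
    have := hfu.norm_le ξ
    have := hmu ξ
    linarith
  have hlog : ∀ ξ, HasSum (fun k : ℕ => (-1) ^ (k + 1 + 1) * h ξ ^ (k + 1) / ((k + 1 : ℕ) : ℂ))
      (Complex.log (1 + h ξ)) := by
    intro ξ
    have := Complex.hasSum_taylorSeries_log (hh1 ξ)
    -- The term of index zero is a division by zero, hence `0`, and can be dropped.
    rw [← hasSum_nat_add_iff' 1] at this
    simpa using this
  have hsum : Summable fun k : ℕ => (1 / 4 : ℝ) ^ (k + 1) + C * (1 / 2) ^ (k + 1) := by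
    refine Summable.add ?_ (Summable.mul_left _ ?_)
    · exact (summable_nat_add_iff 1).2 (summable_geometric_of_lt_one (by norm_num) (by norm_num))
    · exact (summable_nat_add_iff 1).2 (summable_geometric_of_lt_one (by norm_num) (by norm_num))
  obtain ⟨g, hg, hgF, -⟩ := (hLM.add (IsFourierL1.hasSum hterm hsum hlog)).exists_integrable
  refine ⟨g, hg, fun ξ => ?_⟩
  have h1h : 1 + h ξ ≠ 0 := by
    intro h0
    have : h ξ = -1 := by linear_combination h0
    have := hh1 ξ
    simp_all
  rw [hgF, Complex.exp_add, hLu, Complex.exp_log h1h, hh]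
  have := hune ξ
  field_simp
  ring

end WienerLevy

/-! ### Integration of bounded functions against complex measures. -/

section BoundedIntegral

variable {X Y : Type*} [MeasurableSpace X] [MeasurableSpace Y]

/-- Functionals on the bounded measurable functions that are additive and continuous under
dominated convergence. -/
structure IsBoundedIntegral (I : (X → ℂ) → ℂ) : Prop where
  add : ∀ f g : X → ℂ, Measurable f → Measurable g → (∃ C, ∀ x, ‖f x‖ ≤ C) →
    (∃ C, ∀ x, ‖g x‖ ≤ C) → I (fun x => f x + g x) = I f + I g
  tendsto : ∀ (F : ℕ → X → ℂ) (f : X → ℂ) (C : ℝ), (∀ k, Measurable (F k)) →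
    (∀ k x, ‖F k x‖ ≤ C) → (∀ x, Tendsto (fun k => F k x) atTop (𝓝 (f x))) →
    Tendsto (fun k => I (F k)) atTop (𝓝 (I f))

/-- Additivity passes from indicators to simple functions, and uniformly bounded simple
approximation gives the rest. Identities between different kinds of integral thereby reduce to
indicators. -/
lemma IsBoundedIntegral.ext {I J : (X → ℂ) → ℂ} (hI : IsBoundedIntegral I)
    (hJ : IsBoundedIntegral J)
    (h : ∀ (c : ℂ) (s : Set X), MeasurableSet s →
      I (s.indicator fun _ => c) = J (s.indicator fun _ => c))
    {f : X → ℂ} (hf : Measurable f) {C : ℝ} (hC : ∀ x, ‖f x‖ ≤ C) : I f = J f := by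
  have hs : ∀ F : SimpleFunc X ℂ, I F = J F := by
    intro F
    induction F using SimpleFunc.induction with
    | const c hs =>
      simp only [SimpleFunc.const_zero, Function.const_def]
      exact h c _ hs
    | add _ hF hG =>
      rename_i F G _
      have h1 := hI.add F G F.measurable G.measurable F.exists_forall_norm_le
        G.exists_forall_norm_le
      have h2 := hJ.add F G F.measurable G.measurable F.exists_forall_norm_le
        G.exists_forall_norm_le
      have h3 : ⇑(F + G) = fun x => F x + G x := rfl
      rw [h3, h1, h2, hF, hG]
  rcases isEmpty_or_nonempty X with hX | ⟨⟨x₀⟩⟩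
  · have : f = (0 : SimpleFunc X ℂ) := by ext x; exact hX.elim x
    rw [this, hs]
  have hC0 : 0 ≤ C := (norm_nonneg _).trans (hC x₀)
  have hsm := hf.stronglyMeasurable
  have hlim : ∀ x, Tendsto (fun k => hsm.approxBounded C k x) atTop (𝓝 (f x)) :=
    fun x => hsm.tendsto_approxBounded_of_norm_le (hC x)
  have h1 := hI.tendsto _ f C (fun k => (hsm.approxBounded C k).measurable)
    (fun k x => hsm.norm_approxBounded_le hC0 k x) hlim
  have h2 := hJ.tendsto _ f C (fun k => (hsm.approxBounded C k).measurable)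
    (fun k x => hsm.norm_approxBounded_le hC0 k x) hlim
  simp only [hs] at h1
  exact tendsto_nhds_unique h1 h2

lemma IsBoundedIntegral.add_add {I J : (X → ℂ) → ℂ} (hI : IsBoundedIntegral I)
    (hJ : IsBoundedIntegral J) : IsBoundedIntegral fun f => I f + J f where
  add f g hf hg hf' hg' := by
    rw [hI.add f g hf hg hf' hg', hJ.add f g hf hg hf' hg']
    ring
  tendsto F f C hF hC h := (hI.tendsto F f C hF hC h).add (hJ.tendsto F f C hF hC h)

lemma IsBoundedIntegral.const_mul {I : (X → ℂ) → ℂ} (hI : IsBoundedIntegral I) (c : ℂ) :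
    IsBoundedIntegral fun f => c * I f where
  add f g hf hg hf' hg' := by
    rw [hI.add f g hf hg hf' hg']
    ring
  tendsto F f C hF hC h := (hI.tendsto F f C hF hC h).const_mul c

lemma IsBoundedIntegral.comp_mul {I : (Y → ℂ) → ℂ} (hI : IsBoundedIntegral I) {φ : Y → X}
    (hφ : Measurable φ) {G : Y → ℂ} (hG : Measurable G) {D : ℝ} (hD : ∀ y, ‖G y‖ ≤ D) :
    IsBoundedIntegral fun F : X → ℂ => I fun y => F (φ y) * G y where
  add f g hf hg hf' hg' := by
    obtain ⟨C₁, hC₁⟩ := hf'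
    obtain ⟨C₂, hC₂⟩ := hg'
    have hb : ∀ {f : X → ℂ} {C : ℝ}, (∀ x, ‖f x‖ ≤ C) → ∀ y, ‖f (φ y) * G y‖ ≤ C * D :=
      fun {f C} hC y => by
        rw [norm_mul]
        exact mul_le_mul (hC _) (hD y) (norm_nonneg _) ((norm_nonneg _).trans (hC (φ y)))
    rw [← hI.add (fun y => f (φ y) * G y) (fun y => g (φ y) * G y)
      ((hf.comp hφ).mul hG) ((hg.comp hφ).mul hG)
      ⟨_, hb hC₁⟩ ⟨_, hb hC₂⟩]
    simp only [add_mul]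
  tendsto F f C hF hC h := by
    refine hI.tendsto _ _ (C * D) (fun k => ((hF k).comp hφ).mul hG) (fun k y => ?_)
      fun y => (h (φ y)).mul_const _
    rw [norm_mul]
    exact mul_le_mul (hC _ _) (hD y) (norm_nonneg _) ((norm_nonneg _).trans (hC k (φ y)))

lemma isBoundedIntegral_integral_mul {p : Measure X} {g : X → ℂ} (hg : Integrable g p) :
    IsBoundedIntegral fun f => ∫ x, f x * g x ∂p where
  add f₁ f₂ h₁ h₂ := by
    rintro ⟨C₁, hC₁⟩ ⟨C₂, hC₂⟩
    rw [← integral_add (hg.bdd_mul h₁.aestronglyMeasurable (ae_of_all _ hC₁))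
      (hg.bdd_mul h₂.aestronglyMeasurable (ae_of_all _ hC₂))]
    simp only [add_mul]
  tendsto F f C hF hC h := by
    refine tendsto_integral_of_dominated_convergence (fun x => C * ‖g x‖)
      (fun k => (hF k).aestronglyMeasurable.mul hg.aestronglyMeasurable) (hg.norm.const_mul C)
      (fun k => ae_of_all _ fun x => ?_) (ae_of_all _ fun x => (h x).mul_const _)
    rw [norm_mul]
    exact mul_le_mul_of_nonneg_right (hC k x) (norm_nonneg _)

lemma integrable_vectorMeasure_of_bounded (μ : ComplexMeasure X) {f : X → ℂ} (hf : Measurable f)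
    {C : ℝ} (hC : ∀ x, ‖f x‖ ≤ C) : μ.Integrable f :=
  Integrable.of_bound hf.aestronglyMeasurable C (ae_of_all _ hC)

lemma isBoundedIntegral_vectorMeasure (μ : ComplexMeasure X) :
    IsBoundedIntegral fun f => μ.integral f (ContinuousLinearMap.mul ℝ ℂ) where
  add f₁ f₂ h₁ h₂ := by
    rintro ⟨C₁, hC₁⟩ ⟨C₂, hC₂⟩
    exact VectorMeasure.integral_fun_add (integrable_vectorMeasure_of_bounded μ h₁ hC₁)
      (integrable_vectorMeasure_of_bounded μ h₂ hC₂)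
  tendsto F f C hF hC h :=
    VectorMeasure.tendsto_integral_of_dominated_convergence (fun _ => C)
      (fun k => (hF k).aestronglyMeasurable) (integrable_const C)
      (fun k => ae_of_all _ (hC k)) (ae_of_all _ h)

lemma integral_vectorMeasure_indicator_const (μ : ComplexMeasure X) (c : ℂ) {s : Set X}
    (hs : MeasurableSet s) :
    μ.integral (s.indicator fun _ => c) (ContinuousLinearMap.mul ℝ ℂ) = c * μ s := by
  rw [VectorMeasure.integral_indicator hs, VectorMeasure.integral_const]
  simp [VectorMeasure.restrict_apply, hs]

lemma integral_smul_complexMeasure (μ : ComplexMeasure X) (c : ℂ) {f : X → ℂ} (hf : Measurable f)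
    {C : ℝ} (hC : ∀ x, ‖f x‖ ≤ C) :
    (c • μ).integral f (ContinuousLinearMap.mul ℝ ℂ) =
      c * μ.integral f (ContinuousLinearMap.mul ℝ ℂ) := by
  refine (isBoundedIntegral_vectorMeasure (c • μ)).ext
    ((isBoundedIntegral_vectorMeasure μ).const_mul c) (fun d s hs => ?_) hf hC
  simp only [integral_vectorMeasure_indicator_const _ _ hs, _root_.smul_apply, smul_eq_mul]
  ring

lemma integral_withDensityᵥ {p : Measure X} {g : X → ℂ} (hg : Integrable g p) {f : X → ℂ}
    (hf : Measurable f) {C : ℝ} (hC : ∀ x, ‖f x‖ ≤ C) :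
    (p.withDensityᵥ g).integral f (ContinuousLinearMap.mul ℝ ℂ) = ∫ x, f x * g x ∂p := by
  refine (isBoundedIntegral_vectorMeasure _).ext (isBoundedIntegral_integral_mul hg)
    (fun d s hs => ?_) hf hC
  simp only [integral_vectorMeasure_indicator_const _ _ hs, withDensityᵥ_apply hg hs]
  rw [← integral_const_mul, ← integral_indicator hs]
  congr 1
  ext x
  by_cases hx : x ∈ s <;> simp [hx]

/-- With one factor frozen, each side is a bounded integral in the other. Applying
`IsBoundedIntegral.ext` twice, to `G` with `F` an indicator and then to `F`, leaves only rectangles.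
-/
lemma integral_prod_mul (μ : ComplexMeasure X) (ν : ComplexMeasure Y) {F : X → ℂ} {G : Y → ℂ}
    (hF : Measurable F) (hG : Measurable G) {C D : ℝ} (hC : ∀ x, ‖F x‖ ≤ C)
    (hD : ∀ y, ‖G y‖ ≤ D) :
    (μ.prod ν (ContinuousLinearMap.mul ℝ ℂ)).integral (fun p => F p.1 * G p.2)
      (ContinuousLinearMap.mul ℝ ℂ) =
      μ.integral F (ContinuousLinearMap.mul ℝ ℂ) * ν.integral G (ContinuousLinearMap.mul ℝ ℂ) := by
  have hP := isBoundedIntegral_vectorMeasure (μ.prod ν (ContinuousLinearMap.mul ℝ ℂ))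
  have hind : ∀ {Z : Type _} (s : Set Z) (c : ℂ) (z : Z), ‖s.indicator (fun _ => c) z‖ ≤ ‖c‖ :=
    fun s c z => norm_indicator_le_norm_self (fun _ => c) z
  have step : ∀ (c : ℂ) (s : Set X), MeasurableSet s →
      (μ.prod ν (ContinuousLinearMap.mul ℝ ℂ)).integral
        (fun p => G p.2 * s.indicator (fun _ => c) p.1) (ContinuousLinearMap.mul ℝ ℂ) =
      (c * μ s) * ν.integral G (ContinuousLinearMap.mul ℝ ℂ) := by
    intro c s hs
    refine (hP.comp_mul measurable_snd (G := fun p : X × Y => s.indicator (fun _ => c) p.1)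
      ((measurable_const.indicator hs).comp measurable_fst) (fun p => hind s c p.1)).ext
      ((isBoundedIntegral_vectorMeasure ν).const_mul (c * μ s)) (fun d t ht => ?_) hG hD
    have : (fun p : X × Y => t.indicator (fun _ => d) p.2 * s.indicator (fun _ => c) p.1) =
        (s ×ˢ t).indicator fun _ => d * c := by
      ext p
      by_cases h1 : p.1 ∈ s <;> by_cases h2 : p.2 ∈ t <;> simp [h1, h2, Set.indicator]
    simp only [this, integral_vectorMeasure_indicator_const _ _ ht,
      integral_vectorMeasure_indicator_const _ _ (hs.prod ht), VectorMeasure.prod_apply,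
      ContinuousLinearMap.mul_apply']
    ring
  have := (hP.comp_mul measurable_fst (G := fun p : X × Y => G p.2)
    (hG.comp measurable_snd) (fun p => hD p.2)).ext
      ((isBoundedIntegral_vectorMeasure μ).const_mul
        (ν.integral G (ContinuousLinearMap.mul ℝ ℂ))) (fun c s hs => ?_) hF hC
  · rw [this, mul_comm]
  · rw [integral_vectorMeasure_indicator_const _ _ hs, mul_comm (ν.integral _ _), ← step c s hs]
    simp only [mul_comm]

lemma isBoundedIntegral_fourMeasures (p : Fin 4 → Measure X) [∀ i, IsFiniteMeasure (p i)] :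
    IsBoundedIntegral fun f => (∫ x, f x ∂(p 0) - ∫ x, f x ∂(p 1)) +
      Complex.I * (∫ x, f x ∂(p 2) - ∫ x, f x ∂(p 3)) := by
  have hI : ∀ i, IsBoundedIntegral fun f => ∫ x, f x ∂(p i) := fun i => by
    simpa using isBoundedIntegral_integral_mul (p := p i) (g := fun _ => (1 : ℂ))
      (integrable_const 1)
  have hsub : ∀ i j, IsBoundedIntegral fun f => ∫ x, f x ∂(p i) - ∫ x, f x ∂(p j) := fun i j => by
    simpa [sub_eq_add_neg] using (hI i).add_add ((hI j).const_mul (-1))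
  exact (hsub 0 1).add_add ((hsub 2 3).const_mul Complex.I)

/-- A complex measure as a combination of four finite positive measures. -/
lemma exists_integral_eq_finiteMeasures (μ : ComplexMeasure X) :
    ∃ p : Fin 4 → Measure X, (∀ i, IsFiniteMeasure (p i)) ∧
      (∀ s, MeasurableSet s → μ s = ((p 0).real s - (p 1).real s : ℂ) +
        Complex.I * ((p 2).real s - (p 3).real s : ℂ)) ∧
      ∀ f : X → ℂ, Measurable f → ∀ C : ℝ, (∀ x, ‖f x‖ ≤ C) →
        μ.integral f (ContinuousLinearMap.mul ℝ ℂ) =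
          (∫ x, f x ∂(p 0) - ∫ x, f x ∂(p 1)) +
            Complex.I * (∫ x, f x ∂(p 2) - ∫ x, f x ∂(p 3)) := by
  set a := (ComplexMeasure.re μ).toJordanDecomposition
  set b := (ComplexMeasure.im μ).toJordanDecomposition
  have hfin : ∀ i, IsFiniteMeasure (![a.posPart, a.negPart, b.posPart, b.negPart] i) := by
    intro i
    fin_cases i <;> dsimp <;> infer_instance
  refine ⟨![a.posPart, a.negPart, b.posPart, b.negPart], hfin, ?_⟩
  have hs : ∀ s, MeasurableSet s → μ s = (a.posPart.real s - a.negPart.real s : ℂ) +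
        Complex.I * (b.posPart.real s - b.negPart.real s : ℂ) := by
    intro s hs
    have ha : (μ s).re = a.posPart.real s - a.negPart.real s := by
      have : ComplexMeasure.re μ s = a.toSignedMeasure s := by
        rw [SignedMeasure.toSignedMeasure_toJordanDecomposition]
      rw [JordanDecomposition.toSignedMeasure, sub_apply,
        Measure.toSignedMeasure_apply_measurable hs, Measure.toSignedMeasure_apply_measurable hs]
        at this
      exact this
    have hb : (μ s).im = b.posPart.real s - b.negPart.real s := by
      have : ComplexMeasure.im μ s = b.toSignedMeasure s := by
        rw [SignedMeasure.toSignedMeasure_toJordanDecomposition]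
      rw [JordanDecomposition.toSignedMeasure, sub_apply,
        Measure.toSignedMeasure_apply_measurable hs, Measure.toSignedMeasure_apply_measurable hs]
        at this
      exact this
    apply Complex.ext <;> simp [ha, hb]
  refine ⟨hs, fun f hf C hC => ?_⟩
  refine (isBoundedIntegral_vectorMeasure μ).ext
    (isBoundedIntegral_fourMeasures ![a.posPart, a.negPart, b.posPart, b.negPart])
    (fun c s hms => ?_) hf hC
  simp only [integral_vectorMeasure_indicator_const _ _ hms, hs s hms,
    integral_indicator_const _ hms, Complex.real_smul, Matrix.cons_val]
  ring

end BoundedIntegral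

/-! ### Characteristic functions of complex measures. -/

section CharFn

variable {n : ℕ}

lemma measurable_exp_inner (z : Eucl n) :
    Measurable fun x : Eucl n => Complex.exp (Complex.I * (inner ℝ z x : ℝ)) := by
  fun_prop

lemma norm_exp_inner_le (z x : Eucl n) :
    ‖Complex.exp (Complex.I * (inner ℝ z x : ℝ))‖ ≤ 1 := by
  rw [mul_comm, Complex.norm_exp_ofReal_mul_I]

lemma enorm_charFn_le (μ : ComplexMeasure (Eucl n)) (z : Eucl n) :
    ‖charFn μ z‖ₑ ≤ μ.variation univ := by
  refine (VectorMeasure.enorm_integral_le_of_enorm_le_const (C := 1)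
    (ae_of_all _ fun x => ?_)).trans (le_of_eq ?_)
  · rw [← ofReal_norm]
    simp
  · rw [ContinuousLinearMap.opENorm_mul, one_mul, one_mul]

lemma charFn_add (μ ν : ComplexMeasure (Eucl n)) (z : Eucl n) :
    charFn (μ + ν) z = charFn μ z + charFn ν z :=
  VectorMeasure.integral_add_vectorMeasure
    (integrable_vectorMeasure_of_bounded μ (measurable_exp_inner z) (norm_exp_inner_le z))
    (integrable_vectorMeasure_of_bounded ν (measurable_exp_inner z) (norm_exp_inner_le z))

lemma charFn_smul (c : ℂ) (μ : ComplexMeasure (Eucl n)) (z : Eucl n) :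
    charFn (c • μ) z = c * charFn μ z :=
  integral_smul_complexMeasure μ c (measurable_exp_inner z) (norm_exp_inner_le z)

lemma charFn_sub (μ ν : ComplexMeasure (Eucl n)) (z : Eucl n) :
    charFn (μ - ν) z = charFn μ z - charFn ν z :=
  VectorMeasure.integral_sub_vectorMeasure
    (integrable_vectorMeasure_of_bounded μ (measurable_exp_inner z) (norm_exp_inner_le z))
    (integrable_vectorMeasure_of_bounded ν (measurable_exp_inner z) (norm_exp_inner_le z))

lemma charFn_sum {ι : Type*} (s : Finset ι) (μ : ι → ComplexMeasure (Eucl n)) (z : Eucl n) :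
    charFn (∑ i ∈ s, μ i) z = ∑ i ∈ s, charFn (μ i) z :=
  VectorMeasure.integral_finsetSum_vectorMeasure fun i _ =>
    integrable_vectorMeasure_of_bounded (μ i) (measurable_exp_inner z) (norm_exp_inner_le z)

lemma charFn_delta0 (z : Eucl n) : charFn (delta0 n) z = 1 := by
  rw [charFn, delta0, VectorMeasure.integral_dirac]
  simp

lemma charFn_withDensityᵥ {g : Eucl n → ℂ} (hg : Integrable g) (z : Eucl n) :
    charFn (volume.withDensityᵥ g) z =
      ∫ x, Complex.exp (Complex.I * (inner ℝ z x : ℝ)) * g x :=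
  integral_withDensityᵥ hg (measurable_exp_inner z) (norm_exp_inner_le z)

/-- The rescaling reconciles the kernel `exp (i zᵀx)` with the kernel `exp (-2πi ⟨x, ξ⟩)` of `𝓕`. -/
lemma integral_exp_mul_eq_fourier (g : Eucl n → ℂ) (z : Eucl n) :
    ∫ x, Complex.exp (Complex.I * (inner ℝ z x : ℝ)) * g x = 𝓕 g (-(2 * Real.pi)⁻¹ • z) := by
  rw [Real.fourier_eq']
  refine integral_congr_ae (ae_of_all _ fun x => ?_)
  simp only [smul_eq_mul]
  congr 2
  rw [real_inner_smul_right, real_inner_comm]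
  have : (Real.pi : ℂ) ≠ 0 := by exact_mod_cast Real.pi_ne_zero
  push_cast
  field_simp

lemma charFn_conv (μ ν : ComplexMeasure (Eucl n)) (z : Eucl n) :
    charFn (conv μ ν) z = charFn μ z * charFn ν z := by
  rw [charFn, conv, VectorMeasure.integral_map (by fun_prop)
    (measurable_exp_inner z).aestronglyMeasurable
    (integrable_vectorMeasure_of_bounded _ ((measurable_exp_inner z).comp (by fun_prop))
      (fun p => norm_exp_inner_le z _))]
  have h := integral_prod_mul μ ν (measurable_exp_inner z) (measurable_exp_inner z)
    (norm_exp_inner_le z) (norm_exp_inner_le z)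
  refine Eq.trans ?_ h
  congr 1
  ext p
  rw [inner_add_right, ← Complex.exp_add]
  push_cast
  ring_nf

lemma charFn_convPow (ν : ComplexMeasure (Eucl n)) (j : ℕ) (z : Eucl n) :
    charFn (convPow ν j) z = charFn ν z ^ j := by
  induction j with
  | zero => rw [convPow, charFn_delta0, pow_zero]
  | succ j ih => rw [convPow, charFn_conv, ih, pow_succ']

lemma eq_zero_of_charFn_eq_zero {μ : ComplexMeasure (Eucl n)} (h : ∀ z, charFn μ z = 0) :
    μ = 0 := by
  obtain ⟨p, hp, hps, hpi⟩ := exists_integral_eq_finiteMeasures μ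
  have hc : ∀ (i : Fin 4) (z : Eucl n),
      ∫ x, Complex.exp (Complex.I * (inner ℝ z x : ℝ)) ∂(p i) = MeasureTheory.charFun (p i) z := by
    intro i z
    rw [MeasureTheory.charFun_apply]
    refine integral_congr_ae (ae_of_all _ fun x => ?_)
    simp only [real_inner_comm, mul_comm]
  have h1 : ∀ z, (charFun (p 0) z - charFun (p 1) z) +
      Complex.I * (charFun (p 2) z - charFun (p 3) z) = 0 := by
    intro z
    rw [← h z, charFn, hpi _ (measurable_exp_inner z) 1 (norm_exp_inner_le z)]
    simp only [hc]
  -- Positive measures satisfy `charFun (-z) = conj (charFun z)`, so conjugating `h1` at `-z` flips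
  -- the sign of `I` and separates the real and imaginary parts of `μ`.
  have h2 : ∀ z, (charFun (p 0) z - charFun (p 1) z) -
      Complex.I * (charFun (p 2) z - charFun (p 3) z) = 0 := by
    intro z
    have := congrArg (starRingEnd ℂ) (h1 (-z))
    simp only [charFun_neg, map_add, map_sub, map_mul, Complex.conj_conj, Complex.conj_I,
      map_zero] at this
    linear_combination this
  have h01 : p 0 = p 1 := Measure.ext_of_charFun <| funext fun z => by
    linear_combination (h1 z + h2 z) / 2
  have h23 : p 2 = p 3 := Measure.ext_of_charFun <| funext fun z => by
    linear_combination (-Complex.I) * (h1 z - h2 z) / 2 +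
      (charFun (p 2) z - charFun (p 3) z) * Complex.I_sq
  ext s hs
  rw [hps s hs, h01, h23]
  simp

/-- A complex measure is determined by its characteristic function. -/
lemma ext_of_charFn {μ ν : ComplexMeasure (Eucl n)} (h : ∀ z, charFn μ z = charFn ν z) :
    μ = ν :=
  sub_eq_zero.1 <| eq_zero_of_charFn_eq_zero fun z => by rw [charFn_sub, h, sub_self]

end CharFn

/-! ### The exponential in the convolution algebra. -/

section Exponential

/-- Absolutely convergent series of complex measures converge in total variation. -/
lemma exists_tendsto_variation_sub_sum {X : Type*} [MeasurableSpace X] (ν : ℕ → ComplexMeasure X)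
    (h : ∑' j, (ν j).variation univ ≠ ⊤) :
    ∃ S : ComplexMeasure X, Tendsto
      (fun N => (S - ∑ j ∈ Finset.range N, ν j).variation univ) atTop (𝓝 0) := by
  have hsum : ∀ {ι : Type} {a : ι → ℂ}, ∑' i, ‖a i‖ₑ ≠ ⊤ → Summable a := by
    intro ι a ha
    refine Summable.of_norm ?_
    simpa only [toReal_enorm] using ENNReal.summable_toReal ha
  have hle : ∀ s, ∑' j, ‖ν j s‖ₑ ≤ ∑' j, (ν j).variation univ := fun s =>
    ENNReal.tsum_le_tsum fun j =>
      (VectorMeasure.enorm_measure_le_variation (ν j) s).trans (measure_mono (subset_univ s))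
  have hs : ∀ s, Summable fun j => ν j s := fun s =>
    hsum ((hle s).trans_lt (lt_top_iff_ne_top.2 h)).ne
  let S : ComplexMeasure X :=
    { measureOf' := fun s => ∑' j, ν j s
      empty' := by simp
      not_measurable' := fun s hs => by simp [VectorMeasure.not_measurable _ hs]
      m_iUnion' := fun f hf hd => by
        -- Countable additivity of the sum is an interchange of two summations, justified by
        -- absolute summability of the double series.
        have hF : Summable fun q : ℕ × ℕ => ν q.1 (f q.2) := by
          refine hsum (ne_of_lt (lt_of_le_of_lt ?_ (lt_top_iff_ne_top.2 h)))
          rw [ENNReal.tsum_prod (f := fun j i => ‖ν j (f i)‖ₑ)]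
          refine ENNReal.tsum_le_tsum fun j => ?_
          calc ∑' i, ‖ν j (f i)‖ₑ ≤ ∑' i, (ν j).variation (f i) :=
                ENNReal.tsum_le_tsum fun i => VectorMeasure.enorm_measure_le_variation _ _
            _ = (ν j).variation (⋃ i, f i) := (measure_iUnion hd hf).symm
            _ ≤ _ := measure_mono (subset_univ _)
        have h1 := hF.hasSum.prod_fiberwise fun j => (ν j).m_iUnion hf hd
        have h2 : HasSum (fun q : ℕ × ℕ => ν q.2 (f q.1)) (∑' q : ℕ × ℕ, ν q.1 (f q.2)) :=
          (Equiv.prodComm ℕ ℕ).hasSum_iff.2 hF.hasSum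
        have h3 := h2.prod_fiberwise fun i => (hs (f i)).hasSum
        rwa [← h1.tsum_eq] at h3 }
  have hS : ∀ s, S s = ∑' j, ν j s := fun s => rfl
  refine ⟨S, tendsto_of_tendsto_of_tendsto_of_le_of_le tendsto_const_nhds
    (ENNReal.tendsto_sum_nat_add _ h) (fun N => zero_le) fun N => ?_⟩
  have hvar : (S - ∑ j ∈ Finset.range N, ν j).variation ≤
      Measure.sum fun j => (ν (j + N)).variation := by
    refine VectorMeasure.variation_le_of_forall_enorm_le fun s hms => ?_
    have h1 : (S - ∑ j ∈ Finset.range N, ν j) s = ∑' j, ν (j + N) s := by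
      have h2 : (∑ j ∈ Finset.range N, ν j) s = ∑ j ∈ Finset.range N, ν j s := by
        induction N with
        | zero => simp
        | succ N ih => rw [Finset.sum_range_succ, Finset.sum_range_succ, add_apply, ih]
      rw [sub_apply, hS, h2, ← (hs s).sum_add_tsum_nat_add N]
      ring
    rw [h1, Measure.sum_apply _ hms]
    exact enorm_tsum_le_tsum_enorm.trans
      (ENNReal.tsum_le_tsum fun j => VectorMeasure.enorm_measure_le_variation _ _)
  have := hvar univ
  rwa [Measure.sum_apply _ MeasurableSet.univ] at this

variable {n : ℕ}

lemma variation_conv_univ_le (μ ν : ComplexMeasure (Eucl n)) :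
    (conv μ ν).variation univ ≤ μ.variation univ * ν.variation univ := by
  refine (VectorMeasure.variation_map_le univ).trans ?_
  rw [Measure.map_apply (by fun_prop) MeasurableSet.univ, preimage_univ]
  refine (VectorMeasure.variation_prod_le univ).trans ?_
  rw [ContinuousLinearMap.opENorm_mul, one_smul, ← univ_prod_univ, Measure.prod_prod]

lemma variation_convPow_univ_le (ν : ComplexMeasure (Eucl n)) (j : ℕ) :
    (convPow ν j).variation univ ≤ ν.variation univ ^ j := by
  induction j with
  | zero => simp [convPow, delta0]
  | succ j ih =>
    rw [convPow, pow_succ']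
    exact (variation_conv_univ_le _ _).trans (by gcongr)

lemma exists_isExp (ν : ComplexMeasure (Eucl n)) : ∃ S, IsExp ν S := by
  refine exists_tendsto_variation_sub_sum _ (ne_of_lt (lt_of_le_of_lt (ENNReal.tsum_le_tsum
    (g := fun j => ENNReal.ofReal (ν.variation.real univ ^ j / j.factorial)) fun j => ?_)
    (lt_top_iff_ne_top.2 (Real.summable_pow_div_factorial _).tsum_ofReal_ne_top)))
  rw [VectorMeasure.variation_smul, Measure.smul_apply]
  have h1 : ENNReal.ofReal (ν.variation.real univ ^ j) = ν.variation univ ^ j := by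
    rw [ENNReal.ofReal_pow (by positivity), ofReal_measureReal]
  have h2 : ENNReal.ofReal ((j.factorial : ℝ)⁻¹) = (‖(j.factorial : ℂ)⁻¹‖₊ : ℝ≥0∞) := by
    rw [← enorm_eq_nnnorm, ← ofReal_norm, norm_inv, Complex.norm_natCast]
  rw [div_eq_inv_mul, ENNReal.ofReal_mul (by positivity), h1, h2]
  exact mul_le_mul_right (variation_convPow_univ_le ν j) _

/-- At fixed `z`, `charFn` is multiplicative for convolution and bounded by the total variation, so
it carries the exponential series of measures to the scalar one. -/
lemma IsExp.charFn_eq {ν μ : ComplexMeasure (Eucl n)} (h : IsExp ν μ) (z : Eucl n) :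
    charFn μ z = Complex.exp (charFn ν z) := by
  have h1 : Tendsto (fun N : ℕ => ∑ j ∈ Finset.range N, charFn ν z ^ j / j.factorial) atTop
      (𝓝 (Complex.exp (charFn ν z))) := by
    rw [Complex.exp_eq_exp_ℂ]
    exact (NormedSpace.expSeries_div_hasSum_exp (charFn ν z)).tendsto_sum_nat
  have h2 : ∀ N : ℕ,
      charFn (μ - ∑ j ∈ Finset.range N, ((j.factorial : ℂ)⁻¹) • convPow ν j) z =
        charFn μ z - ∑ j ∈ Finset.range N, charFn ν z ^ j / j.factorial := by
    intro N
    rw [charFn_sub, charFn_sum]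
    simp only [charFn_smul, charFn_convPow, div_eq_inv_mul]
  have h3 : Tendsto (fun N : ℕ =>
      charFn μ z - ∑ j ∈ Finset.range N, charFn ν z ^ j / j.factorial) atTop (𝓝 0) := by
    rw [tendsto_zero_iff_enorm_tendsto_zero]
    refine tendsto_of_tendsto_of_tendsto_of_le_of_le tendsto_const_nhds h (fun N => zero_le)
      fun N => ?_
    simp only [← h2]
    exact enorm_charFn_le _ z
  exact sub_eq_zero.1 (tendsto_nhds_unique (h1.const_sub (charFn μ z)) h3)

end Exponential

/-! ### Lévy type measures with integrable density. -/

section LevyDensity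

variable {n : ℕ}

/-- The Lévy decomposition of the measure with density `g`. -/
def densityParts (g : Eucl n → ℂ) : Fin 4 → Measure (Eucl n) :=
  ![volume.withDensity fun x => ENNReal.ofReal (g x).re,
    volume.withDensity fun x => ENNReal.ofReal (-(g x).re),
    volume.withDensity fun x => ENNReal.ofReal (g x).im,
    volume.withDensity fun x => ENNReal.ofReal (-(g x).im)]

lemma isFiniteMeasure_densityParts {g : Eucl n → ℂ} (hg : Integrable g) (i : Fin 4) :
    IsFiniteMeasure (densityParts g i) := by
  fin_cases i
  · exact isFiniteMeasure_withDensity_ofReal hg.re.2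
  · exact isFiniteMeasure_withDensity_ofReal hg.re.neg.2
  · exact isFiniteMeasure_withDensity_ofReal hg.im.2
  · exact isFiniteMeasure_withDensity_ofReal hg.im.neg.2

lemma setIntegral_eq_densityParts {g : Eucl n → ℂ} (hg : Integrable g) {s : Set (Eucl n)}
    (hs : MeasurableSet s) :
    ∫ x in s, g x = ((densityParts g 0).real s - (densityParts g 1).real s : ℂ) +
      Complex.I * ((densityParts g 2).real s - (densityParts g 3).real s : ℂ) := by
  have key : ∀ {h : Eucl n → ℝ}, Integrable h → ∫ x in s, h x =
      (volume.withDensity fun x => ENNReal.ofReal (h x)).real s -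
        (volume.withDensity fun x => ENNReal.ofReal (-h x)).real s := by
    intro h hh
    have h1 := isFiniteMeasure_withDensity_ofReal hh.2
    have h2 := isFiniteMeasure_withDensity_ofReal hh.neg.2
    have := congrArg (fun v : SignedMeasure (Eucl n) => v s)
      (withDensityᵥ_eq_withDensity_pos_part_sub_withDensity_neg_part hh)
    rw [withDensityᵥ_apply hh hs, sub_apply, Measure.toSignedMeasure_apply_measurable hs,
      Measure.toSignedMeasure_apply_measurable hs] at this
    exact this
  have hre := key hg.re
  have him := key hg.im
  have := integral_re_add_im (hg.integrableOn (s := s))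
  rw [← this]
  simp only [RCLike.re_to_complex, RCLike.im_to_complex] at hre him ⊢
  rw [hre, him, densityParts]
  simp [mul_comm]

/-- The parts are finite measures, so both integrability conditions are immediate; positive
dimension makes the origin a null set. -/
lemma isLevyDecomp_densityParts [Nonempty (Fin n)] {ν : AwayFromZero n → ℂ} {g : Eucl n → ℂ}
    (hg : Integrable g) (hν : HasDensity ν g) : IsLevyDecomp (densityParts g) ν := by
  have hfin := isFiniteMeasure_densityParts hg
  have hlt : ∀ (i : Fin 4) (φ : Eucl n → ℝ), (∀ x, φ x ≤ 1) →
      ∫⁻ x, ENNReal.ofReal (φ x) ∂(densityParts g i) < ⊤ := by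
    intro i φ hφ
    refine lt_of_le_of_lt (lintegral_mono (g := fun _ => 1) fun x => ?_) ?_
    · exact ENNReal.ofReal_le_one.2 (hφ x)
    · simp
  have h0 : ∀ i, densityParts g i {0} = 0 := by
    intro i
    fin_cases i <;> exact withDensity_absolutelyContinuous _ _ (measure_singleton 0)
  refine ⟨fun i => ⟨h0 i, hlt i _ fun x => min_le_left _ _⟩,
    fun i => hlt i _ fun x => min_le_left _ _, fun B => ?_⟩
  rw [hν B, setIntegral_eq_densityParts hg B.2.1]

/-- For integrable `g` the compensating `-1` splits off as a constant, which can later be moved into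
the factor `c`. -/
lemma levyIntegral_of_hasDensity [Nonempty (Fin n)] {ν : AwayFromZero n → ℂ} {g : Eucl n → ℂ}
    (hg : Integrable g) (hν : HasDensity ν g) (z : Eucl n) :
    levyIntegral ν (fun x => Complex.exp (Complex.I * (inner ℝ z x : ℝ)) - 1) =
      charFn (volume.withDensityᵥ g) z - ∫ x, g x := by
  have hfin := isFiniteMeasure_densityParts hg
  have hm : Measurable fun x : Eucl n => Complex.exp (Complex.I * (inner ℝ z x : ℝ)) - 1 :=
    (measurable_exp_inner z).sub_const 1
  rw [levyIntegral_eq (isLevyDecomp_densityParts hg hν) hm (norm_exp_sub_one_le z)]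
  have hb : ∀ x : Eucl n, ‖Complex.exp (Complex.I * (inner ℝ z x : ℝ)) - 1‖ ≤ 1 + 1 := fun x =>
    (norm_sub_le _ _).trans (add_le_add (norm_exp_inner_le z x) norm_one.le)
  have h1 : decompIntegral (densityParts g)
      (fun x => Complex.exp (Complex.I * (inner ℝ z x : ℝ)) - 1) =
      ∫ x, (Complex.exp (Complex.I * (inner ℝ z x : ℝ)) - 1) * g x := by
    refine (isBoundedIntegral_fourMeasures (densityParts g)).ext
      (isBoundedIntegral_integral_mul hg) (fun c s hs => ?_) hm hb
    have h2 : ∫ x, s.indicator (fun _ => c) x * g x = c * ∫ x in s, g x := by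
      rw [← integral_const_mul, ← integral_indicator hs]
      congr 1
      ext x
      by_cases hx : x ∈ s <;> simp [hx]
    rw [h2, setIntegral_eq_densityParts hg hs]
    simp only [integral_indicator_const _ hs, Complex.real_smul]
    ring
  rw [h1, charFn_withDensityᵥ hg, ← integral_sub _ hg]
  · simp only [sub_mul, one_mul]
  · exact hg.bdd_mul (measurable_exp_inner z).aestronglyMeasurable
      (ae_of_all _ (norm_exp_inner_le z))

end LevyDensity

/-! ### Zero-free characteristic functions and the equivalences. -/

section Main

variable {n : ℕ}

lemma charFn_ne_zero_of_isInvertible {μ : ComplexMeasure (Eucl n)} (h : IsInvertible μ)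
    (z : Eucl n) : charFn μ z ≠ 0 := by
  obtain ⟨μ', hμ'⟩ := h
  have := charFn_conv μ' μ z
  rw [hμ', charFn_delta0] at this
  exact right_ne_zero_of_mul (this ▸ one_ne_zero)

lemma charFn_ne_zero_of_mem_CLK {μ : ComplexMeasure (Eucl n)} (h : μ ∈ CLK n) (z : Eucl n) :
    charFn μ z ≠ 0 := by
  obtain ⟨c, γ, ν, h⟩ := h
  rw [h.charFn_eq]
  exact mul_ne_zero h.ne_zero (Complex.exp_ne_zero _)

lemma IsExp.isInvertible {ν μ : ComplexMeasure (Eucl n)} (h : IsExp ν μ) : IsInvertible μ := by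
  obtain ⟨S, hS⟩ := exists_isExp ((-1 : ℂ) • ν)
  refine ⟨S, ext_of_charFn fun z => ?_⟩
  rw [charFn_conv, hS.charFn_eq, h.charFn_eq, charFn_smul, charFn_delta0, ← Complex.exp_add]
  simp

lemma exists_charFn_eq_mul_exp (hn : 2 ≤ n) {α : ℂ} (hα : α ≠ 0) {f : Eucl n → ℂ}
    (hf : Integrable f)
    (hne : ∀ z, charFn (α • delta0 n + volume.withDensityᵥ f) z ≠ 0) :
    ∃ g : Eucl n → ℂ, Integrable g ∧ ∀ z, charFn (α • delta0 n + volume.withDensityᵥ f) z =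
      α * Complex.exp (charFn (volume.withDensityᵥ g) z) := by
  have hV : 1 < Module.rank ℝ (Eucl n) := by
    rw [← Module.finrank_eq_rank, finrank_euclideanSpace_fin]
    exact_mod_cast hn
  have hf' : Integrable (α⁻¹ • f) := hf.smul _
  have hμ : ∀ z, charFn (α • delta0 n + volume.withDensityᵥ f) z =
      α * (1 + 𝓕 (α⁻¹ • f) (-(2 * Real.pi)⁻¹ • z)) := by
    intro z
    rw [← integral_exp_mul_eq_fourier, ← charFn_withDensityᵥ hf', withDensityᵥ_smul, charFn_add,
      charFn_smul, charFn_smul, charFn_delta0]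
    field_simp
  obtain ⟨g, hg, hgf⟩ := exists_exp_fourier_eq hV hf' fun ξ h0 => by
    refine hne (-(2 * Real.pi) • ξ) ?_
    have hpi : -(2 * Real.pi)⁻¹ * -(2 * Real.pi) = 1 := by
      have := Real.pi_ne_zero
      field_simp
    rw [hμ, smul_smul, hpi, one_smul, h0, mul_zero]
  refine ⟨g, hg, fun z => ?_⟩
  rw [hμ, charFn_withDensityᵥ hg, integral_exp_mul_eq_fourier, hgf]

end Main

end InvertibleMeasures

end

open InvertibleMeasures in
theorem theorem4p3 (n : ℕ) (hn : 2 ≤ n) (α : ℂ) (hα : α ≠ 0)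
    (f : EuclideanSpace ℝ (Fin n) → ℂ) (hf : MeasureTheory.Integrable f)
    (μ : MeasureTheory.ComplexMeasure (EuclideanSpace ℝ (Fin n)))
    (hμ : μ = α • delta0 n + MeasureTheory.volume.withDensityᵥ f) :
    List.TFAE [
      IsInvertible μ,
      μ ∈ CLK n,
      ∃ (c : ℂ) (ν : AwayFromZero n → ℂ), HasLKRep μ c 0 ν ∧
        ∃ g : EuclideanSpace ℝ (Fin n) → ℂ, MeasureTheory.Integrable g ∧ HasDensity ν g,
      ∃ ν' : MeasureTheory.ComplexMeasure (EuclideanSpace ℝ (Fin n)), IsExp ν' μ] := by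
  have : Nonempty (Fin n) := ⟨⟨0, by omega⟩⟩
  have key : (∀ z, charFn μ z ≠ 0) →
      ∃ (c : ℂ) (ν : AwayFromZero n → ℂ), HasLKRep μ c 0 ν ∧
        ∃ g : EuclideanSpace ℝ (Fin n) → ℂ, MeasureTheory.Integrable g ∧ HasDensity ν g := by
    intro hne
    rw [hμ] at hne
    obtain ⟨g, hg, hgμ⟩ := exists_charFn_eq_mul_exp hn hα hf hne
    have hν : HasDensity (fun B : AwayFromZero n => ∫ x in B.1, g x) g := fun B => rfl
    -- The factor `exp (∫ g)` compensates the `-∫ g` in the Lévy integral.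
    refine ⟨α * Complex.exp (∫ x, g x), _, ⟨mul_ne_zero hα (Complex.exp_ne_zero _),
      ⟨_, isLevyDecomp_densityParts hg hν⟩, fun z => ?_⟩, g, hg, hν⟩
    rw [hμ, hgμ, levyIntegral_of_hasDensity hg hν, mul_assoc, ← Complex.exp_add]
    simp
  tfae_have 1 → 3 := fun h => key (charFn_ne_zero_of_isInvertible h)
  tfae_have 2 → 3 := fun h => key (charFn_ne_zero_of_mem_CLK h)
  tfae_have 3 → 2 := fun ⟨c, ν, h, _⟩ => ⟨c, 0, ν, h⟩
  tfae_have 3 → 4 := by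
    rintro ⟨c, ν, h, g, hg, hν⟩
    let ν' : MeasureTheory.ComplexMeasure (EuclideanSpace ℝ (Fin n)) :=
      -- The multiple of `δ₀` adds a constant to the characteristic function: `log c` restores the
      -- factor `c`, and `-∫ g` the compensating term.
      (Complex.log c - ∫ x, g x) • delta0 n + MeasureTheory.volume.withDensityᵥ g
    obtain ⟨S, hS⟩ := exists_isExp ν'
    have hSμ : S = μ := ext_of_charFn fun z => by
      rw [hS.charFn_eq, h.charFn_eq, levyIntegral_of_hasDensity hg hν, charFn_add, charFn_smul,
        charFn_delta0, inner_zero_left]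
      nth_rewrite 2 [← Complex.exp_log h.ne_zero]
      rw [← Complex.exp_add]
      push_cast
      ring_nf
    exact ⟨ν', hSμ ▸ hS⟩
  tfae_have 4 → 1 := fun ⟨_, h⟩ => h.isInvertible
  tfae_finish
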